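/- Let $n,m\in\mathbb N$, $T>0$, let $U\subset\mathbb R^m$ be nonempty, connected and compact, $\xi\in\mathbb R^n$, and let $f(t,x,u)\in\mathbb R^n$ and $\Psi(x)\in\mathbb R$ be such that $\Psi$ is differentiable on $\mathbb R^n$, $f$ has partial derivatives $\partial f/\partial x$ and $\partial f/\partial u$ at the points of $[0,T]\times\mathbb R^n\times U$, and $\Psi$, $\partial\Psi/\partial x$, and (on $[0,T]\times\mathbb R^n\times U$, jointly in $(t,x,u)$) $f$, $\partial f/\partial x$, $\partial f/\partial u$ are Lipschitz continuous. All differential equations below are understood in the Carathéodory sense (absolutely continuous solutions on $[0,T]$, equation for a.e. $t$). Relaxed problem: minimize $\Psi(x(T))$ over the set $\mathcal X$ of pairs $(x,\mu)$, where $\mu=(\mu_t)_{t\in[0,T]}$ is a measurable family of Borel probability measures on $\mathbb R^m$ with $\operatorname{supp}\mu_t\subset U$ for a.e. $t$, and $$x(0)=\xi,\qquad \dot x(t)=\int f(t,x(t),u)\,d\mu_t(u).$$ For $(x,\mu)\in\mathcal X$ call a measurable family $\delta\mu=(\delta\mu_t)_{t\in[0,T]}$ of finite signed Borel measures on $\mathbb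 R^m$ admissible if for a.e. $t$: $\operatorname{supp}(\delta\mu_t+\mu_t)\subset U$, $\delta\mu_t+\mu_t\ge 0$ and $\int d\delta\mu_t=0$. Define $$\theta_l(x,\mu)=\min_{\delta x,\,\delta\mu}\ \frac{\partial\Psi}{\partial x}(x(T))^{\top}\delta x(T)$$ over admissible $\delta\mu$ and $\delta x$ satisfying $$\delta x(0)=0,\qquad \dot{\delta x}(t)=\int\frac{\partial f}{\partial x}(t,x(t),u)\,d\mu_t(u)\,\delta x(t)+\int f(t,x(t),u)\,d\delta\mu_t(u),$$ and $$\theta_h(x,\mu)=\min_{\delta\mu}\ \int_0^T p(t)^{\top}\!\int f(t,x(t),u)\,d\delta\mu_t(u)\,dt$$ over admissible $\delta\mu$, where the costate $p$ is defined on $[0,T]$ by $$p(T)=\frac{\partial\Psi}{\partial x}(x(T)),\qquad \dot p(t)=-\int\frac{\partial f}{\partial x}(t,x(t),u)^{\top}d\mu_t(u)\,p(t).$$ Then $\theta_l$ and $\theta_h$ are well defined on $\mathcal X$ (the costate exists and is unique on $[0,T]$, and both minima are attained), and they are optimality functions of the relaxed problem: $\theta_l(x,\mu)\le 0$ and $\theta_h(x,\mu)\le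 0$ for every $(x,\mu)\in\mathcal X$, and $\theta_l(\hat x,\hat\mu)=\theta_h(\hat x,\hat\mu)=0$ for every minimizer $(\hat x,\hat\mu)$ of the relaxed problem. -/

import Mathlib

open MeasureTheory Set

/-- The data of an input-constrained optimal control problem with state space `ℝⁿ` and input
space `ℝᵐ`: the horizon `T`, the input set `U`, the initial state `ξ`, the vector field
`f t x u` and the final cost `Ψ`. -/
structure ControlProblem (n m : ℕ) where
  T : ℝ
  U : Set (EuclideanSpace ℝ (Fin m))
  ξ : EuclideanSpace ℝ (Fin n)
  f : ℝ → EuclideanSpace ℝ (Fin n) → EuclideanSpace ℝ (Fin m) → EuclideanSpace ℝ (Fin n)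
  Ψ : EuclideanSpace ℝ (Fin n) → ℝ

namespace ControlProblem

variable {n m : ℕ}

/-- The partial derivative `∂f/∂x (t, x, u)`. -/
noncomputable def dfx (P : ControlProblem n m) (t : ℝ) (x : EuclideanSpace ℝ (Fin n))
    (u : EuclideanSpace ℝ (Fin m)) : EuclideanSpace ℝ (Fin n) →L[ℝ] EuclideanSpace ℝ (Fin n) :=
  fderiv ℝ (fun y => P.f t y u) x

/-- The partial derivative `∂f/∂u (t, x, u)`. -/
noncomputable def dfu (P : ControlProblem n m) (t : ℝ) (x : EuclideanSpace ℝ (Fin n))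
    (u : EuclideanSpace ℝ (Fin m)) : EuclideanSpace ℝ (Fin m) →L[ℝ] EuclideanSpace ℝ (Fin n) :=
  fderiv ℝ (fun w => P.f t x w) u

/-- `f` and `Ψ` are Lipschitz continuously differentiable: the derivatives exist, and one constant
`L` is a Lipschitz constant of `Ψ`, `∂Ψ/∂x`, `f`, `∂f/∂x` and `∂f/∂u` on `[0,T] × ℝⁿ × U`
(Euclidean norms and the operator norms they induce). -/
structure LipschitzDifferentiable (P : ControlProblem n m) : Prop where
  diff_cost : ∀ x, DifferentiableAt ℝ P.Ψ x
  diff_state : ∀ t ∈ Icc 0 P.T, ∀ x, ∀ u ∈ P.U, DifferentiableAt ℝ (fun y => P.f t y u) x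
  diff_input : ∀ t ∈ Icc 0 P.T, ∀ x, ∀ u ∈ P.U, DifferentiableAt ℝ (fun w => P.f t x w) u
  lipschitz : ∃ L : ℝ, 0 < L ∧
    (∀ x₁ x₂, |P.Ψ x₁ - P.Ψ x₂| ≤ L * ‖x₁ - x₂‖) ∧
    (∀ x₁ x₂, ‖fderiv ℝ P.Ψ x₁ - fderiv ℝ P.Ψ x₂‖ ≤ L * ‖x₁ - x₂‖) ∧
    (∀ t₁ ∈ Icc 0 P.T, ∀ t₂ ∈ Icc 0 P.T, ∀ x₁ x₂, ∀ u₁ ∈ P.U, ∀ u₂ ∈ P.U,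
      ‖P.f t₁ x₁ u₁ - P.f t₂ x₂ u₂‖ ≤ L * (|t₁ - t₂| + ‖x₁ - x₂‖ + ‖u₁ - u₂‖)) ∧
    (∀ t₁ ∈ Icc 0 P.T, ∀ t₂ ∈ Icc 0 P.T, ∀ x₁ x₂, ∀ u₁ ∈ P.U, ∀ u₂ ∈ P.U,
      ‖P.dfx t₁ x₁ u₁ - P.dfx t₂ x₂ u₂‖ ≤ L * (|t₁ - t₂| + ‖x₁ - x₂‖ + ‖u₁ - u₂‖)) ∧
    (∀ t₁ ∈ Icc 0 P.T, ∀ t₂ ∈ Icc 0 P.T, ∀ x₁ x₂, ∀ u₁ ∈ P.U, ∀ u₂ ∈ P.U,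
      ‖P.dfu t₁ x₁ u₁ - P.dfu t₂ x₂ u₂‖ ≤ L * (|t₁ - t₂| + ‖x₁ - x₂‖ + ‖u₁ - u₂‖))

/-- A pair of a state trajectory and a process of probability measures on the input space. Only
the values at times in `[0,T]` matter. -/
abbrev Pair (n m : ℕ) : Type :=
  (ℝ → EuclideanSpace ℝ (Fin n)) × (ℝ → ProbabilityMeasure (EuclideanSpace ℝ (Fin m)))

/-- The pair `(x, μ)` is feasible for the relaxed problem: `μ` is (Lebesgue) measurable in time and
a.e. supported in `U`, and `x` is the Carathéodory solution of
`x(0) = ξ`, `ẋ(t) = ∫ f(t, x(t), u) dμ_t(u)`, written as an integral equation. -/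
structure IsFeasible (P : ControlProblem n m) (z : Pair n m) : Prop where
  measurable : AEMeasurable (fun t => (z.2 t : Measure (EuclideanSpace ℝ (Fin m))))
    (volume.restrict (Icc 0 P.T))
  support : ∀ᵐ t ∂(volume.restrict (Icc 0 P.T)),
    (z.2 t : Measure (EuclideanSpace ℝ (Fin m))).support ⊆ P.U
  integrable : IntervalIntegrable
    (fun s => ∫ u, P.f s (z.1 s) u ∂(z.2 s : Measure (EuclideanSpace ℝ (Fin m)))) volume 0 P.T
  trajectory : ∀ t ∈ Icc 0 P.T, z.1 t = P.ξ +
    ∫ s in 0..t, ∫ u, P.f s (z.1 s) u ∂(z.2 s : Measure (EuclideanSpace ℝ (Fin m)))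

/-- The feasible set of the relaxed problem. -/
def feasibleSet (P : ControlProblem n m) : Set (Pair n m) := {z | P.IsFeasible z}

/-- The objective `Ψ(x(T))` of the relaxed problem. -/
def cost (P : ControlProblem n m) (z : Pair n m) : ℝ := P.Ψ (z.1 P.T)

/-- `δμ : [0,T] → signed measures` is an admissible variation of the process `μ₀`: it is measurable
in time and, for a.e. `t`, `supp (δμ_t + μ₀_t) ⊆ U`, `δμ_t + μ₀_t ≥ 0` and `∫ dδμ_t = 0`. -/
structure IsAdmissibleVariation (P : ControlProblem n m)
    (μ₀ : ℝ → ProbabilityMeasure (EuclideanSpace ℝ (Fin m)))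
    (δμ : ℝ → SignedMeasure (EuclideanSpace ℝ (Fin m))) : Prop where
  measurable : ∀ s : Set (EuclideanSpace ℝ (Fin m)), MeasurableSet s →
    AEMeasurable (fun t => δμ t s) (volume.restrict (Icc 0 P.T))
  support : ∀ᵐ t ∂(volume.restrict (Icc 0 P.T)),
    (δμ t + (μ₀ t : Measure (EuclideanSpace ℝ (Fin m))).toSignedMeasure).variation.support ⊆ P.U
  nonneg : ∀ᵐ t ∂(volume.restrict (Icc 0 P.T)),
    0 ≤ δμ t + (μ₀ t : Measure (EuclideanSpace ℝ (Fin m))).toSignedMeasure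
  mass : ∀ᵐ t ∂(volume.restrict (Icc 0 P.T)), δμ t univ = 0

/-- The right-hand side of the equation of `δx`, linearized along `(x, μ₀)`, at time `s`:
`∫ ∂f/∂x(s, x(s), u) dμ₀_s(u) δx(s) + ∫ f(s, x(s), u) dδμ_s(u)`. -/
noncomputable def linearizedField (P : ControlProblem n m) (z : Pair n m)
    (δμ : ℝ → SignedMeasure (EuclideanSpace ℝ (Fin m))) (δx : ℝ → EuclideanSpace ℝ (Fin n))
    (s : ℝ) : EuclideanSpace ℝ (Fin n) :=
  (∫ u, P.dfx s (z.1 s) u ∂(z.2 s : Measure (EuclideanSpace ℝ (Fin m)))) (δx s)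
    + ∫ᵛ u, P.f s (z.1 s) u ∂<•(δμ s)

/-- `δx` is the Carathéodory solution, with `δx(0) = 0`, of the linearized equation. -/
structure IsLinearizedTrajectory (P : ControlProblem n m) (z : Pair n m)
    (δμ : ℝ → SignedMeasure (EuclideanSpace ℝ (Fin m)))
    (δx : ℝ → EuclideanSpace ℝ (Fin n)) : Prop where
  integrable : IntervalIntegrable (P.linearizedField z δμ δx) volume 0 P.T
  trajectory : ∀ t ∈ Icc 0 P.T, δx t = ∫ s in 0..t, P.linearizedField z δμ δx s

/-- The objective values `∂Ψ/∂x(x(T))ᵀ δx(T)` of the feasible points of the problem that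
defines `θ_l`. -/
def valuesL (P : ControlProblem n m) (z : Pair n m) : Set ℝ :=
  {v | ∃ (δx : ℝ → EuclideanSpace ℝ (Fin n)) (δμ : ℝ → SignedMeasure (EuclideanSpace ℝ (Fin m))),
    P.IsAdmissibleVariation z.2 δμ ∧ P.IsLinearizedTrajectory z δμ δx ∧
    v = fderiv ℝ P.Ψ (z.1 P.T) (δx P.T)}

/-- The function `θ_l`. -/
noncomputable def thetaL (P : ControlProblem n m) (z : Pair n m) : ℝ := sInf (P.valuesL z)

/-- The Hamiltonian `H(t, x, ν, p) = pᵀ ∫ f(t, x, u) dν(u)`, for a signed measure `ν`. -/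
noncomputable def hamiltonian (P : ControlProblem n m) (t : ℝ) (x : EuclideanSpace ℝ (Fin n))
    (ν : SignedMeasure (EuclideanSpace ℝ (Fin m))) (p : EuclideanSpace ℝ (Fin n)) : ℝ :=
  inner ℝ p (∫ᵛ u, P.f t x u ∂<•ν)

/-- The vector `∫ ∂f/∂x(s, x(s), u)ᵀ dμ_s(u) p(s)`. -/
noncomputable def adjointField (P : ControlProblem n m) (z : Pair n m)
    (p : ℝ → EuclideanSpace ℝ (Fin n)) (s : ℝ) : EuclideanSpace ℝ (Fin n) :=
  (∫ u, ContinuousLinearMap.adjoint (P.dfx s (z.1 s) u)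
    ∂(z.2 s : Measure (EuclideanSpace ℝ (Fin m)))) (p s)

/-- `p` is a costate of `(x, μ)`: the Carathéodory solution on `[0,T]` of
`p(T) = ∂Ψ/∂x(x(T))`, `ṗ(t) = - ∫ ∂f/∂x(t, x(t), u)ᵀ dμ_t(u) p(t)`. -/
structure IsCostate (P : ControlProblem n m) (z : Pair n m)
    (p : ℝ → EuclideanSpace ℝ (Fin n)) : Prop where
  integrable : IntervalIntegrable (P.adjointField z p) volume 0 P.T
  costate : ∀ t ∈ Icc 0 P.T,
    p t = gradient P.Ψ (z.1 P.T) + ∫ s in t..P.T, P.adjointField z p s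

open Classical in
/-- The costate of `(x, μ)` (and `0` if there were none). -/
noncomputable def costate (P : ControlProblem n m) (z : Pair n m) :
    ℝ → EuclideanSpace ℝ (Fin n) :=
  if h : ∃ p, P.IsCostate z p then h.choose else 0

/-- The objective values `∫₀ᵀ H(t, x(t), δμ_t, p(t)) dt` of the feasible points of the problem that
defines `θ_h`. -/
noncomputable def valuesH (P : ControlProblem n m) (z : Pair n m) : Set ℝ :=
  {v | ∃ δμ : ℝ → SignedMeasure (EuclideanSpace ℝ (Fin m)), P.IsAdmissibleVariation z.2 δμ ∧
    v = ∫ t in 0..P.T, P.hamiltonian t (z.1 t) (δμ t) (P.costate z t)}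

/-- The function `θ_h`. -/
noncomputable def thetaH (P : ControlProblem n m) (z : Pair n m) : ℝ := sInf (P.valuesH z)

end ControlProblem

/-- `θ` is an optimality function of the problem of minimizing `J` over `S`: it is nonpositive
on `S` and vanishes at each minimizer. -/
def IsOptimalityFunction {X : Type*} (S : Set X) (J : X → ℝ) (θ : X → ℝ) : Prop :=
  (∀ z ∈ S, θ z ≤ 0) ∧ ∀ z ∈ S, IsMinOn J S z → θ z = 0

/-!
The variations admissible at a relaxed control `μ` are exactly the differences `ν - μ` with relaxed
controls `ν`. Integration by parts against the costate turns `∂Ψ/∂x(x(T))ᵀ δx(T)` into the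
Hamiltonian integral of `ν - μ`, so `θ_l` and `θ_h` minimize over the same set of values, which
contains `0`. A measurable selection of a pointwise minimizer of `u ↦ p(t)ᵀ f(t, x(t), u)` attains
the minimum. Relaxed controls form a convex set, and by Gronwall's inequality the final state of
the trajectory of `(1 - ε)μ + εν` has right derivative `δx(T)` at `ε = 0`; hence no value is
negative at a minimizer.
-/

open Filter Topology Function
open scoped NNReal InnerProductSpace

section CaratheodoryEquations

open scoped Nat

theorem intervalIntegrable_of_mem_Icc {E : Type*} [NormedAddCommGroup E] {g : ℝ → E}
    {a b : ℝ} (hg : IntervalIntegrable g volume a b) {s t : ℝ} (hs : s ∈ Icc a b)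
    (ht : t ∈ Icc a b) : IntervalIntegrable g volume s t :=
  hg.mono_set ((uIcc_subset_Icc hs ht).trans Icc_subset_uIcc)

variable {E : Type*} [NormedAddCommGroup E] [NormedSpace ℝ E]
  {F : ℝ → E → E} {K : ℝ≥0} {a b t₀ : ℝ} {x₀ : E} {x y w : ℝ → E}

/-- `x` is a Carathéodory solution on `[a, b]` of `ẋ(t) = F(t, x(t))`, `x(t₀) = x₀`. Absolute
continuity and the equation almost everywhere are encoded by the integral equation. -/
structure IsCaratheodorySolution (F : ℝ → E → E) (a b t₀ : ℝ) (x₀ : E) (x : ℝ → E) : Prop where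
  intervalIntegrable : IntervalIntegrable (fun s => F s (x s)) volume a b
  eq_picard : EqOn x (ODE.picard F t₀ x₀ x) (Icc a b)

/-- The hypotheses of the global existence theorem for Carathéodory solutions: `F` is Lipschitz in
the state, uniformly in time, and integrable along continuous curves. -/
structure IsLipschitzCaratheodory (F : ℝ → E → E) (K : ℝ≥0) (a b : ℝ) : Prop where
  intervalIntegrable_comp : ∀ {x : ℝ → E}, ContinuousOn x (Icc a b) →
    IntervalIntegrable (fun s => F s (x s)) volume a b
  ae_lipschitzWith : ∀ᵐ s ∂volume.restrict (Icc a b), LipschitzWith K (F s)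

theorem continuousOn_picard (hF : IntervalIntegrable (fun s => F s (x s)) volume a b)
    (ht₀ : t₀ ∈ Icc a b) : ContinuousOn (ODE.picard F t₀ x₀ x) (Icc a b) := by
  have h := intervalIntegral.continuousOn_primitive_interval' hF (Icc_subset_uIcc ht₀)
  exact continuousOn_const.add (h.mono Icc_subset_uIcc)

theorem IsCaratheodorySolution.continuousOn (hx : IsCaratheodorySolution F a b t₀ x₀ x)
    (ht₀ : t₀ ∈ Icc a b) : ContinuousOn x (Icc a b) :=
  (continuousOn_picard hx.intervalIntegrable ht₀).congr hx.eq_picard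

theorem IsCaratheodorySolution.congr_ae {G : ℝ → E → E}
    (hx : IsCaratheodorySolution F a b t₀ x₀ x) (ht₀ : t₀ ∈ Icc a b)
    (h : ∀ᵐ s ∂volume.restrict (Icc a b), F s (x s) = G s (x s)) :
    IsCaratheodorySolution G a b t₀ x₀ x where
  intervalIntegrable := hx.intervalIntegrable.congr_ae <|
    ae_restrict_of_ae_restrict_of_subset
      (uIoc_subset_uIcc.trans_eq (uIcc_of_le (ht₀.1.trans ht₀.2))) h
  eq_picard t ht := by
    rw [hx.eq_picard ht, ODE.picard_apply, ODE.picard_apply]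
    refine congrArg (x₀ + ·) (intervalIntegral.integral_congr_ae_restrict ?_)
    exact ae_restrict_of_ae_restrict_of_subset
      (uIoc_subset_uIcc.trans (uIcc_subset_Icc ht₀ ht)) h

theorem isLipschitzCaratheodory_affine {A : ℝ → E →L[ℝ] E} {c : ℝ → E} (hab : a ≤ b)
    (hA : IntervalIntegrable A volume a b) (hAK : ∀ᵐ s ∂volume.restrict (Icc a b), ‖A s‖ ≤ K)
    (hc : IntervalIntegrable c volume a b) :
    IsLipschitzCaratheodory (fun s y => A s y + c s) K a b where
  intervalIntegrable_comp hx := by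
    refine IntervalIntegrable.add ?_ hc
    rw [intervalIntegrable_iff_integrableOn_Icc_of_le hab] at hA ⊢
    obtain ⟨C, hC⟩ := isCompact_Icc.exists_bound_of_continuousOn hx
    exact (ContinuousLinearMap.id ℝ (E →L[ℝ] E)).integrable_of_bilin_of_bdd_right C hA
      (hx.aestronglyMeasurable_of_isCompact isCompact_Icc measurableSet_Icc)
      ((ae_restrict_iff' measurableSet_Icc).2 (ae_of_all _ hC))
  ae_lipschitzWith := hAK.mono fun s hs =>
    (((A s).lipschitz.weaken hs).add (LipschitzWith.const (c s))).weaken (add_zero K).le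

namespace IsLipschitzCaratheodory

/-- The Picard operator `y ↦ x₀ + ∫_{t₀} F(s, y(s)) ds` on the continuous curves on `[a, b]`. -/
noncomputable def picardMap (hF : IsLipschitzCaratheodory F K a b) (t₀ : Icc a b) (x₀ : E)
    (y : C(Icc a b, E)) : C(Icc a b, E) where
  toFun t := ODE.picard F t₀ x₀ (IccExtend (t₀.2.1.trans t₀.2.2) y) t
  continuous_toFun := continuousOn_iff_continuous_domRestrict.1 <| continuousOn_picard
    (hF.intervalIntegrable_comp y.continuous.Icc_extend'.continuousOn) t₀.2

theorem dist_picardMap_iterate_apply_le (hF : IsLipschitzCaratheodory F K a b) (t₀ : Icc a b)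
    (x₀ : E) (y z : C(Icc a b, E)) (n : ℕ) (t : Icc a b) :
    dist ((hF.picardMap t₀ x₀)^[n] y t) ((hF.picardMap t₀ x₀)^[n] z t) ≤
      (K * |(t : ℝ) - t₀|) ^ n / n ! * dist y z := by
  have hab : a ≤ b := t₀.2.1.trans t₀.2.2
  induction n generalizing t with
  | zero => simpa using ContinuousMap.dist_apply_le_dist t
  | succ n ih =>
    set Y := (hF.picardMap t₀ x₀)^[n] y with hY
    set Z := (hF.picardMap t₀ x₀)^[n] z with hZ
    have hint (w : C(Icc a b, E)) :
        IntervalIntegrable (fun s => F s (IccExtend hab w s)) volume t₀ t :=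
      intervalIntegrable_of_mem_Icc
        (hF.intervalIntegrable_comp w.continuous.Icc_extend'.continuousOn) t₀.2 t.2
    have hsub : uIoc (t₀ : ℝ) t ⊆ Icc a b := uIoc_subset_uIcc.trans (uIcc_subset_Icc t₀.2 t.2)
    rw [iterate_succ_apply', iterate_succ_apply', ← hY, ← hZ]
    calc dist (hF.picardMap t₀ x₀ Y t) (hF.picardMap t₀ x₀ Z t)
        = ‖∫ s in (t₀ : ℝ)..t, (F s (IccExtend hab Y s) - F s (IccExtend hab Z s))‖ := by
          rw [intervalIntegral.integral_sub (hint Y) (hint Z), dist_eq_norm]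
          exact congrArg norm (add_sub_add_left_eq_sub _ _ _)
      _ ≤ ∫ s in uIoc (t₀ : ℝ) t, K * ((K * |s - t₀|) ^ n / n ! * dist y z) := by
          rw [intervalIntegral.norm_intervalIntegral_eq]
          refine norm_integral_le_of_norm_le (Continuous.integrableOn_uIoc (by fun_prop)) ?_
          filter_upwards [ae_restrict_of_ae_restrict_of_subset hsub hF.ae_lipschitzWith,
            ae_restrict_mem measurableSet_uIoc] with s hs hst
          rw [← dist_eq_norm, IccExtend_of_mem hab _ (hsub hst), IccExtend_of_mem hab _ (hsub hst)]
          exact (hs.dist_le_mul _ _).trans (by gcongr; exact ih ⟨s, hsub hst⟩)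
      _ = K ^ (n + 1) / n ! * dist y z * ∫ s in uIoc (t₀ : ℝ) t, |s - t₀| ^ n := by
          rw [← integral_const_mul]
          congr with s
          ring
      _ = (K * |(t : ℝ) - t₀|) ^ (n + 1) / (n + 1)! * dist y z := by
          rw [integral_pow_abs_sub_uIoc, Nat.factorial_succ, mul_pow]
          push_cast
          field_simp

theorem exists_contractingWith_picardMap_iterate (hF : IsLipschitzCaratheodory F K a b)
    (t₀ : Icc a b) (x₀ : E) :
    ∃ (n : ℕ) (C : ℝ≥0), ContractingWith C (hF.picardMap t₀ x₀)^[n] := by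
  have hab : 0 ≤ b - a := sub_nonneg.2 (t₀.2.1.trans t₀.2.2)
  obtain ⟨n, hn⟩ := ((FloorSemiring.tendsto_pow_div_factorial_atTop (K * (b - a))).eventually
    (gt_mem_nhds zero_lt_one)).exists
  have hC : 0 ≤ (K * (b - a)) ^ n / n ! := by positivity
  refine ⟨n, ⟨_, hC⟩, hn, LipschitzWith.of_dist_le_mul fun y z =>
    (ContinuousMap.dist_le (mul_nonneg hC dist_nonneg)).2 fun t =>
      (hF.dist_picardMap_iterate_apply_le t₀ x₀ y z n t).trans ?_⟩
  change _ ≤ (K * (b - a)) ^ n / n ! * dist y z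
  gcongr
  exact abs_sub_le_of_le_of_le t.2.1 t.2.2 t₀.2.1 t₀.2.2

theorem exists_isCaratheodorySolution [CompleteSpace E] (hF : IsLipschitzCaratheodory F K a b)
    (ht₀ : t₀ ∈ Icc a b) (x₀ : E) : ∃ x, IsCaratheodorySolution F a b t₀ x₀ x := by
  have hab : a ≤ b := ht₀.1.trans ht₀.2
  obtain ⟨n, C, hC⟩ := hF.exists_contractingWith_picardMap_iterate ⟨t₀, ht₀⟩ x₀
  have : Nonempty C(Icc a b, E) := ⟨0⟩
  obtain ⟨y, hy⟩ : ∃ y, hF.picardMap ⟨t₀, ht₀⟩ x₀ y = y := ⟨_, hC.isFixedPt_fixedPoint_iterate⟩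
  refine ⟨IccExtend hab y, hF.intervalIntegrable_comp y.continuous.Icc_extend'.continuousOn,
    fun t ht => ?_⟩
  rw [IccExtend_of_mem hab _ ht]
  exact (DFunLike.congr_fun hy ⟨t, ht⟩).symm

theorem isFixedPt_picardMap (hF : IsLipschitzCaratheodory F K a b) (ht₀ : t₀ ∈ Icc a b)
    (hx : IsCaratheodorySolution F a b t₀ x₀ x) :
    IsFixedPt (hF.picardMap ⟨t₀, ht₀⟩ x₀) ⟨(Icc a b).domRestrict x,
      continuousOn_iff_continuous_domRestrict.1 (hx.continuousOn ht₀)⟩ := by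
  ext t
  refine Eq.trans ?_ (hx.eq_picard t.2).symm
  refine congrArg (x₀ + ·) (intervalIntegral.integral_congr fun s hs => ?_)
  exact congrArg (F s) (IccExtend_of_mem _ _ (uIcc_subset_Icc ht₀ t.2 hs))

theorem eqOn_of_isCaratheodorySolution (hF : IsLipschitzCaratheodory F K a b)
    (ht₀ : t₀ ∈ Icc a b) (hx : IsCaratheodorySolution F a b t₀ x₀ x)
    (hy : IsCaratheodorySolution F a b t₀ x₀ y) : EqOn x y (Icc a b) := by
  obtain ⟨n, C, hC⟩ := hF.exists_contractingWith_picardMap_iterate ⟨t₀, ht₀⟩ x₀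
  have h := hC.fixedPoint_unique' ((hF.isFixedPt_picardMap ht₀ hx).iterate n)
    ((hF.isFixedPt_picardMap ht₀ hy).iterate n)
  exact fun t ht => DFunLike.congr_fun h ⟨t, ht⟩

end IsLipschitzCaratheodory

theorem gronwallBound_zero_left (K c x : ℝ) :
    gronwallBound 0 K c x = c * gronwallBound 0 K 1 x := by
  rcases eq_or_ne K 0 with rfl | hK
  · simp [gronwallBound_K0]
  · simp only [gronwallBound_of_K_ne_0 hK]
    ring

namespace IsCaratheodorySolution

variable {G : ℝ → E → E} {y₀ : E}

theorem sub (hx : IsCaratheodorySolution F a b t₀ x₀ x) (hy : IsCaratheodorySolution G a b t₀ y₀ y)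
    (ht₀ : t₀ ∈ Icc a b) :
    IsCaratheodorySolution (fun s _ => F s (x s) - G s (y s)) a b t₀ (x₀ - y₀) (x - y) where
  intervalIntegrable := hx.intervalIntegrable.sub hy.intervalIntegrable
  eq_picard t ht := by
    rw [Pi.sub_apply, hx.eq_picard ht, hy.eq_picard ht]
    simp only [ODE.picard_apply]
    rw [intervalIntegral.integral_sub
      (intervalIntegrable_of_mem_Icc hx.intervalIntegrable ht₀ ht)
      (intervalIntegrable_of_mem_Icc hy.intervalIntegrable ht₀ ht)]
    abel

theorem const_smul (hx : IsCaratheodorySolution F a b t₀ x₀ x) (c : ℝ) :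
    IsCaratheodorySolution (fun s _ => c • F s (x s)) a b t₀ (c • x₀) (c • x) where
  intervalIntegrable := hx.intervalIntegrable.smul c
  eq_picard t ht := by
    rw [Pi.smul_apply, hx.eq_picard ht]
    simp only [ODE.picard_apply, intervalIntegral.integral_smul, smul_add]

theorem norm_le_gronwallBound {K c : ℝ} (hx : IsCaratheodorySolution F a b a 0 x) (hK : 0 ≤ K)
    (hc : 0 ≤ c) (hF : ∀ᵐ s ∂volume.restrict (Icc a b), ‖F s (x s)‖ ≤ K * ‖x s‖ + c) :
    ∀ t ∈ Icc a b, ‖x t‖ ≤ gronwallBound 0 K c (t - a) := by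
  intro t₁ ht₁
  have hab : a ≤ b := ht₁.1.trans ht₁.2
  have hcont : ContinuousOn x (Icc a b) := hx.continuousOn (left_mem_Icc.2 hab)
  set w : ℝ → ℝ := fun t => K * ‖IccExtend hab ((Icc a b).domRestrict x) t‖ + c
  have hw : Continuous w := by
    have := (continuousOn_iff_continuous_domRestrict.1 hcont).Icc_extend' (h := hab)
    fun_prop
  have hw0 (t : ℝ) : 0 ≤ w t := by positivity
  have hwx {t : ℝ} (ht : t ∈ Icc a b) : w t = K * ‖x t‖ + c := by
    simp only [w, IccExtend_of_mem hab _ ht, domRestrict_apply]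
  have hle : ∀ t ∈ Icc a b, ‖x t‖ ≤ ∫ s in a..t, w s := fun t ht => by
    rw [hx.eq_picard ht, ODE.picard_apply, zero_add]
    refine intervalIntegral.norm_integral_le_of_norm_le ht.1 ?_ (hw.intervalIntegrable _ _)
    filter_upwards [(ae_restrict_iff' measurableSet_Icc).1 hF] with s hs hst
    have hs' : s ∈ Icc a b := ⟨hst.1.le, hst.2.trans ht.2⟩
    exact (hs hs').trans_eq (hwx hs').symm
  have hV (t : ℝ) : HasDerivAt (fun t => ∫ s in a..t, w s) (w t) t :=
    (hw.integral_hasStrictDerivAt a t).hasDerivAt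
  refine (hle t₁ ht₁).trans ((Real.le_norm_self _).trans ?_)
  refine norm_le_gronwallBound_of_norm_deriv_right_le
    (fun t _ => (hV t).continuousAt.continuousWithinAt) (fun t _ => (hV t).hasDerivWithinAt)
    (by simp) (fun t ht => ?_) t₁ ht₁
  rw [Real.norm_of_nonneg (hw0 t), hwx (Ico_subset_Icc_self ht)]
  gcongr
  exact (hle t (Ico_subset_Icc_self ht)).trans (Real.le_norm_self _)

variable {D : ℝ → E → E} {A : ℝ → E →L[ℝ] E} {M : ℝ≥0} {B ε : ℝ}

theorem norm_sub_le_of_perturbation (hx : IsCaratheodorySolution F a b a x₀ x)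
    (hy : IsCaratheodorySolution (fun s z => F s z + ε • D s z) a b a x₀ y)
    (hF : ∀ᵐ s ∂volume.restrict (Icc a b), LipschitzWith K (F s))
    (hD : ∀ᵐ s ∂volume.restrict (Icc a b), LipschitzWith M (D s)) (hB₀ : 0 ≤ B)
    (hB : ∀ᵐ s ∂volume.restrict (Icc a b), ‖D s (x s)‖ ≤ B) (hε : ε ∈ Icc (0 : ℝ) 1) :
    ∀ t ∈ Icc a b, ‖y t - x t‖ ≤ ε * (B * gronwallBound 0 (K + M) 1 (b - a)) := by
  intro t ht
  have he := hy.sub hx (left_mem_Icc.2 (ht.1.trans ht.2))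
  rw [sub_self] at he
  refine (he.norm_le_gronwallBound (K := K + M) (c := ε * B) (by positivity)
    (mul_nonneg hε.1 hB₀) ?_ t ht).trans ?_
  · filter_upwards [hF, hD, hB] with s hFs hDs hBs
    calc ‖F s (y s) + ε • D s (y s) - F s (x s)‖
        = ‖F s (y s) - F s (x s) + ε • (D s (y s) - D s (x s)) + ε • D s (x s)‖ := by
          congr 1; module
      _ ≤ K * ‖y s - x s‖ + ε * (M * ‖y s - x s‖) + ε * B := by
          refine norm_add₃_le.trans ?_
          rw [norm_smul_of_nonneg hε.1, norm_smul_of_nonneg hε.1]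
          gcongr
          exacts [hFs.norm_sub_le _ _, hε.1, hDs.norm_sub_le _ _, hε.1]
      _ ≤ K * ‖y s - x s‖ + 1 * (M * ‖y s - x s‖) + ε * B := by
          gcongr; exact hε.2
      _ = (K + M) * ‖(y - x) s‖ + ε * B := by rw [Pi.sub_apply]; ring
  · rw [gronwallBound_zero_left, mul_assoc]
    have := gronwallBound_mono le_rfl zero_le_one (by positivity : 0 ≤ (K + M : ℝ))
      (sub_le_sub_right ht.2 a)
    have := hε.1
    gcongr

theorem norm_sub_sub_smul_le_of_perturbation {R c : ℝ} (hx : IsCaratheodorySolution F a b a x₀ x)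
    (hy : IsCaratheodorySolution (fun s z => F s z + ε • D s z) a b a x₀ y)
    (hw : IsCaratheodorySolution (fun s z => A s z + D s (x s)) a b a 0 w)
    (hA : ∀ᵐ s ∂volume.restrict (Icc a b), ‖A s‖ ≤ K)
    (hD : ∀ᵐ s ∂volume.restrict (Icc a b), LipschitzWith M (D s))
    (hFA : ∀ᵐ s ∂volume.restrict (Icc a b),
      ‖F s (y s) - F s (x s) - A s (y s - x s)‖ ≤ c * ‖y s - x s‖)
    (hc : 0 ≤ c) (hR₀ : 0 ≤ R) (hR : ∀ s ∈ Icc a b, ‖y s - x s‖ ≤ R) (hε : 0 ≤ ε) :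
    ∀ t ∈ Icc a b, ‖y t - x t - ε • w t‖ ≤ (c + ε * M) * R * gronwallBound 0 K 1 (t - a) := by
  intro t ht
  have hta := left_mem_Icc.2 (ht.1.trans ht.2)
  have he := (hy.sub hx hta).sub (hw.const_smul ε) hta
  rw [sub_self, smul_zero, sub_zero] at he
  rw [← gronwallBound_zero_left]
  refine he.norm_le_gronwallBound K.2 (by positivity) ?_ t ht
  filter_upwards [hA, hD, hFA, ae_restrict_mem measurableSet_Icc] with s hAs hDs hFs hs
  calc ‖F s (y s) + ε • D s (y s) - F s (x s) - ε • (A s (w s) + D s (x s))‖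
      = ‖A s (y s - x s - ε • w s) + (F s (y s) - F s (x s) - A s (y s - x s))
          + ε • (D s (y s) - D s (x s))‖ := by
        simp only [map_sub, map_smul]
        congr 1; module
    _ ≤ K * ‖y s - x s - ε • w s‖ + c * ‖y s - x s‖ + ε * (M * ‖y s - x s‖) := by
        refine norm_add₃_le.trans ?_
        rw [norm_smul_of_nonneg hε]
        gcongr
        exacts [(A s).le_of_opNorm_le hAs _, hDs.norm_sub_le _ _]
    _ = K * ‖y s - x s - ε • w s‖ + (c + ε * M) * ‖y s - x s‖ := by ring
    _ ≤ K * ‖y s - x s - ε • w s‖ + (c + ε * M) * R := by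
        gcongr; exact hR s hs

theorem hasDerivWithinAt_of_perturbation {X : ℝ → ℝ → E} (hab : a ≤ b)
    (hx : IsCaratheodorySolution F a b a x₀ x)
    (hX : ∀ ε ∈ Icc (0 : ℝ) 1,
      IsCaratheodorySolution (fun s z => F s z + ε • D s z) a b a x₀ (X ε))
    (hw : IsCaratheodorySolution (fun s z => A s z + D s (x s)) a b a 0 w)
    (hF : ∀ᵐ s ∂volume.restrict (Icc a b), LipschitzWith K (F s))
    (hA : ∀ᵐ s ∂volume.restrict (Icc a b), ‖A s‖ ≤ K)
    (hFA : ∀ η > 0, ∃ δ > 0, ∀ᵐ s ∂volume.restrict (Icc a b), ∀ y, ‖y - x s‖ ≤ δ →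
      ‖F s y - F s (x s) - A s (y - x s)‖ ≤ η * ‖y - x s‖)
    (hD : ∀ᵐ s ∂volume.restrict (Icc a b), LipschitzWith M (D s)) (hB₀ : 0 ≤ B)
    (hB : ∀ᵐ s ∂volume.restrict (Icc a b), ‖D s (x s)‖ ≤ B) :
    HasDerivWithinAt (fun ε => X ε b) (w b) (Icc 0 1) 0 := by
  set C := B * gronwallBound 0 (K + M) 1 (b - a)
  set G := gronwallBound 0 K 1 (b - a)
  have hbb := right_mem_Icc.2 hab
  have hXx {ε : ℝ} (hε : ε ∈ Icc (0 : ℝ) 1) : ∀ t ∈ Icc a b, ‖X ε t - x t‖ ≤ ε * C :=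
    hx.norm_sub_le_of_perturbation (hX ε hε) hF hD hB₀ hB hε
  have hC : 0 ≤ C := by simpa using (norm_nonneg _).trans (hXx (right_mem_Icc.2 zero_le_one) b hbb)
  have hX₀ : X 0 b = x b := by
    simpa [sub_eq_zero] using hXx (left_mem_Icc.2 zero_le_one) b hbb
  rw [hasDerivWithinAt_iff_isLittleO, Asymptotics.isLittleO_iff]
  intro c hc
  obtain ⟨η, hη, hηc⟩ := exists_pos_mul_lt hc (C * G)
  obtain ⟨δ, hδ, hδη⟩ := hFA η hη
  have hsmall : ∀ᶠ ε in 𝓝 (0 : ℝ), (η + ε * M) * C * G < c :=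
    Continuous.tendsto' (by fun_prop) 0 (η * C * G) (by ring) |>.eventually_lt_const
      (by linarith)
  have hclose : ∀ᶠ ε in 𝓝 (0 : ℝ), ε * C < δ :=
    Continuous.tendsto' (by fun_prop) 0 0 (zero_mul C) |>.eventually_lt_const hδ
  filter_upwards [hsmall.filter_mono nhdsWithin_le_nhds, hclose.filter_mono nhdsWithin_le_nhds,
    self_mem_nhdsWithin] with ε hεc hεδ hε
  have hrem : ∀ᵐ s ∂volume.restrict (Icc a b),
      ‖F s (X ε s) - F s (x s) - A s (X ε s - x s)‖ ≤ η * ‖X ε s - x s‖ := by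
    filter_upwards [hδη, ae_restrict_mem measurableSet_Icc] with s hs hst
    exact hs _ ((hXx hε s hst).trans hεδ.le)
  rw [hX₀, sub_zero, Real.norm_of_nonneg hε.1]
  calc ‖X ε b - x b - ε • w b‖
      ≤ (η + ε * M) * (ε * C) * G := hx.norm_sub_sub_smul_le_of_perturbation (hX ε hε) hw hA hD
        hrem hη.le (mul_nonneg hε.1 hC) (hXx hε) hε.1 b hbb
    _ = (η + ε * M) * C * G * ε := by ring
    _ ≤ c * ε := mul_le_mul_of_nonneg_right hεc.le hε.1

end IsCaratheodorySolution

end CaratheodoryEquations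

section Duality

theorem intervalIntegral_triangle_swap {F : Type*} [NormedAddCommGroup F] [NormedSpace ℝ F]
    {a b : ℝ} (hab : a ≤ b) {H : ℝ → ℝ → F}
    (hH : Integrable (uncurry H)
      ((volume.restrict (Ioc a b)).prod (volume.restrict (Ioc a b)))) :
    ∫ s in a..b, ∫ r in s..b, H s r = ∫ r in a..b, ∫ s in a..r, H s r := by
  set G : ℝ → ℝ → F := curry ({z : ℝ × ℝ | z.1 < z.2}.indicator (uncurry H))
  have hG : Integrable (uncurry G)
      ((volume.restrict (Ioc a b)).prod (volume.restrict (Ioc a b))) :=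
    hH.indicator (measurableSet_lt measurable_fst measurable_snd)
  have hright {s : ℝ} (hs : s ∈ Ioc a b) : ∫ r in s..b, H s r = ∫ r in Ioc a b, G s r := by
    have : Ioc a b ∩ Ioi s = Ioc s b := by ext r; grind
    rw [intervalIntegral.integral_of_le hs.2, ← this, ← setIntegral_indicator measurableSet_Ioi]
    rfl
  have hleft {r : ℝ} (hr : r ∈ Ioc a b) : ∫ s in a..r, H s r = ∫ s in Ioc a b, G s r := by
    have : Ioc a b ∩ Iio r = Ioo a r := by ext s; grind
    rw [intervalIntegral.integral_of_le hr.1.le, integral_Ioc_eq_integral_Ioo, ← this,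
      ← setIntegral_indicator measurableSet_Iio]
    rfl
  rw [intervalIntegral.integral_of_le hab, intervalIntegral.integral_of_le hab,
    setIntegral_congr_fun measurableSet_Ioc fun s hs => hright hs,
    setIntegral_congr_fun measurableSet_Ioc fun r hr => hleft hr]
  exact integral_integral_swap hG

variable {E : Type*} [NormedAddCommGroup E] [InnerProductSpace ℝ E]
  {a b : ℝ} {g q e p : ℝ → E}

theorem intervalIntegrable_inner_of_continuousOn (hab : a ≤ b) (hp : ContinuousOn p (Icc a b))
    (hg : IntervalIntegrable g volume a b) :
    IntervalIntegrable (fun t => ⟪p t, g t⟫_ℝ) volume a b := by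
  rw [intervalIntegrable_iff_integrableOn_Icc_of_le hab] at hg ⊢
  obtain ⟨C, hC⟩ := isCompact_Icc.exists_bound_of_continuousOn hp
  exact (innerSL ℝ).integrable_of_bilin_of_bdd_left C
    (hp.aestronglyMeasurable_of_isCompact isCompact_Icc measurableSet_Icc)
    ((ae_restrict_iff' measurableSet_Icc).2 (ae_of_all _ hC)) hg

theorem integral_inner_integral_swap [CompleteSpace E] (hab : a ≤ b)
    (hg : IntervalIntegrable g volume a b) (hq : IntervalIntegrable q volume a b) :
    ∫ s in a..b, ⟪∫ r in s..b, q r, g s⟫_ℝ = ∫ r in a..b, ⟪q r, ∫ s in a..r, g s⟫_ℝ := by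
  have hH : Integrable (uncurry fun s r => ⟪q r, g s⟫_ℝ)
      ((volume.restrict (Ioc a b)).prod (volume.restrict (Ioc a b))) :=
    hg.1.op_fst_snd (op := fun x y => ⟪y, x⟫_ℝ) (by fun_prop)
      ⟨1, fun x y => by rw [one_mul, mul_comm]; exact norm_inner_le_norm y x⟩ hq.1
  have hmem {t : ℝ} (ht : t ∈ uIcc a b) : t ∈ Icc a b := uIcc_of_le hab ▸ ht
  calc ∫ s in a..b, ⟪∫ r in s..b, q r, g s⟫_ℝ
      = ∫ s in a..b, ∫ r in s..b, ⟪q r, g s⟫_ℝ := intervalIntegral.integral_congr fun s hs => by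
        have hqs := intervalIntegrable_of_mem_Icc hq (hmem hs) (right_mem_Icc.2 hab)
        simp only [real_inner_comm (g s)]
        exact ((innerSL ℝ (g s)).intervalIntegral_comp_comm hqs).symm
    _ = ∫ r in a..b, ∫ s in a..r, ⟪q r, g s⟫_ℝ := intervalIntegral_triangle_swap hab hH
    _ = ∫ r in a..b, ⟪q r, ∫ s in a..r, g s⟫_ℝ := intervalIntegral.integral_congr fun r hr =>
        (innerSL ℝ (q r)).intervalIntegral_comp_comm
          (intervalIntegrable_of_mem_Icc hg (left_mem_Icc.2 hab) (hmem hr))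

theorem integral_inner_sub_inner_of_eq_integral [CompleteSpace E] (hab : a ≤ b) {p₁ : E}
    (hg : IntervalIntegrable g volume a b) (hq : IntervalIntegrable q volume a b)
    (he : ∀ t ∈ Icc a b, e t = ∫ s in a..t, g s)
    (hp : ∀ t ∈ Icc a b, p t = p₁ + ∫ s in t..b, q s) :
    ∫ t in a..b, (⟪p t, g t⟫_ℝ - ⟪q t, e t⟫_ℝ) = ⟪p₁, e b⟫_ℝ := by
  have hmem {t : ℝ} (ht : t ∈ uIcc a b) : t ∈ Icc a b := uIcc_of_le hab ▸ ht
  have hQ : ContinuousOn (fun t => ∫ s in t..b, q s) (Icc a b) := by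
    simp only [intervalIntegral.integral_symm b]
    exact ((intervalIntegral.continuousOn_primitive_interval' hq right_mem_uIcc).mono
      Icc_subset_uIcc).neg
  have hG : ContinuousOn (fun t => ∫ s in a..t, g s) (Icc a b) :=
    (intervalIntegral.continuousOn_primitive_interval' hg left_mem_uIcc).mono Icc_subset_uIcc
  have hQg := intervalIntegrable_inner_of_continuousOn hab hQ hg
  have hqG : IntervalIntegrable (fun t => ⟪q t, ∫ s in a..t, g s⟫_ℝ) volume a b := by
    simpa only [real_inner_comm] using intervalIntegrable_inner_of_continuousOn hab hG hq
  have hp₁ := intervalIntegrable_inner_of_continuousOn hab (continuousOn_const (c := p₁)) hg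
  calc ∫ t in a..b, (⟪p t, g t⟫_ℝ - ⟪q t, e t⟫_ℝ)
      = ∫ t in a..b, (⟪p₁, g t⟫_ℝ + ⟪∫ s in t..b, q s, g t⟫_ℝ - ⟪q t, ∫ s in a..t, g s⟫_ℝ) :=
        intervalIntegral.integral_congr fun t ht => by
          simp only [hp t (hmem ht), he t (hmem ht), inner_add_left]
    _ = ∫ t in a..b, ⟪p₁, g t⟫_ℝ := by
        rw [intervalIntegral.integral_sub (hp₁.add hQg) hqG, intervalIntegral.integral_add hp₁ hQg,
          integral_inner_integral_swap hab hg hq, add_sub_cancel_right]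
    _ = ⟪p₁, e b⟫_ℝ := by
        rw [he b (right_mem_Icc.2 hab)]
        exact (innerSL ℝ p₁).intervalIntegral_comp_comm hg

theorem integral_adjoint [CompleteSpace E] {Ω : Type*} [MeasurableSpace Ω] {ρ : Measure Ω}
    (A : Ω → E →L[ℝ] E) :
    ∫ u, ContinuousLinearMap.adjoint (A u) ∂ρ = ContinuousLinearMap.adjoint (∫ u, A u ∂ρ) :=
  let L := ContinuousLinearMap.adjoint (𝕜 := ℝ) (E := E) (F := E)
  L.toContinuousLinearEquiv.integral_comp_comm A

end Duality

section MeasurableSelection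

variable {X Y : Type*} [TopologicalSpace X] [MeasurableSpace X] [OpensMeasurableSpace X]

theorem exists_measurable_isMinOn_of_isCompact_real {C : Set ℝ} (hC : IsCompact C)
    (hne : C.Nonempty) {k : X × C → ℝ} (hk : Continuous k) :
    ∃ σ : X → C, Measurable σ ∧ ∀ x c, k (x, σ x) ≤ k (x, c) := by
  have : CompactSpace C := isCompact_iff_compactSpace.1 hC
  have : Nonempty C := hne.to_subtype
  -- The least minimizer is measurable: its sublevel sets are projections of closed sets along `C`.
  have hleast (x : X) : ∃ c, IsLeast {c | ∀ c', k (x, c) ≤ k (x, c')} c := by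
    refine IsCompact.exists_isLeast (IsClosed.isCompact ?_) ?_
    · simp only [ofPred_forall]
      exact isClosed_iInter fun c' => isClosed_le (by fun_prop) (by fun_prop)
    · obtain ⟨c, -, hc⟩ := isCompact_univ.exists_isMinOn univ_nonempty
        (f := fun c => k (x, c)) (by fun_prop)
      exact ⟨c, fun c' => hc (mem_univ c')⟩
  choose σ hσ using hleast
  refine ⟨σ, Measurable.subtype_mk (measurable_of_Iic fun α => ?_), fun x => (hσ x).1⟩
  have hclosed : IsClosed {z : X × C | (z.2 : ℝ) ≤ α ∧ ∀ c', k z ≤ k (z.1, c')} := by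
    rw [ofPred_and, ofPred_forall]
    exact (isClosed_le (by fun_prop) (by fun_prop)).inter
      (isClosed_iInter fun c' => isClosed_le (by fun_prop) (by fun_prop))
  have hproj : (fun x => (σ x : ℝ)) ⁻¹' Iic α =
      Prod.fst '' {z : X × C | (z.2 : ℝ) ≤ α ∧ ∀ c', k z ≤ k (z.1, c')} := by
    ext x
    constructor
    · exact fun hx => ⟨(x, σ x), ⟨hx, (hσ x).1⟩, rfl⟩
    · rintro ⟨⟨x, c⟩, ⟨hcα, hc⟩, rfl⟩
      exact (Subtype.coe_le_coe.2 ((hσ x).2 hc)).trans hcα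
  exact hproj ▸ (isClosedMap_fst_of_compactSpace _ hclosed).measurableSet

variable [TopologicalSpace Y] [TopologicalSpace.MetrizableSpace Y] [MeasurableSpace Y]
  [BorelSpace Y]

theorem exists_measurable_isMinOn_of_compactSpace [CompactSpace Y] [Nonempty Y] {h : X × Y → ℝ}
    (hh : Continuous h) : ∃ σ : X → Y, Measurable σ ∧ ∀ x y, h (x, σ x) ≤ h (x, y) := by
  obtain ⟨G, hG, hGsurj⟩ : ∃ G : cantorSet → Y, Continuous G ∧ Surjective G := by
    let := TopologicalSpace.metrizableSpaceMetric Y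
    obtain ⟨G, hG, hGsurj⟩ := exists_nat_bool_continuous_surjective_of_compact Y
    exact ⟨G ∘ cantorSetHomeomorphNatToBool, hG.comp cantorSetHomeomorphNatToBool.continuous,
      hGsurj.comp cantorSetHomeomorphNatToBool.surjective⟩
  obtain ⟨σ, hσ, hmin⟩ := exists_measurable_isMinOn_of_isCompact_real isCompact_cantorSet
    ⟨0, zero_mem_cantorSet⟩ (k := fun z : X × cantorSet => h (z.1, G z.2)) (by fun_prop)
  exact ⟨G ∘ σ, hG.measurable.comp hσ, fun x => hGsurj.forall.2 (hmin x)⟩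

theorem exists_measurable_isMinOn_of_isCompact {S : Set X} (hS : MeasurableSet S) {U : Set Y}
    (hU : IsCompact U) (hne : U.Nonempty) {h : X → Y → ℝ}
    (hh : ContinuousOn (uncurry h) (S ×ˢ U)) :
    ∃ σ : X → Y, Measurable σ ∧ (∀ x, σ x ∈ U) ∧ ∀ x ∈ S, IsMinOn (h x) U (σ x) := by
  have : CompactSpace U := isCompact_iff_compactSpace.1 hU
  have : Nonempty U := hne.to_subtype
  obtain ⟨τ, hτ, hmin⟩ := exists_measurable_isMinOn_of_compactSpace
    (h := fun z : S × U => h z.1 z.2) <| hh.comp_continuous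
      (f := fun z : S × U => ((z.1 : X), (z.2 : Y))) (by fun_prop) fun z => ⟨z.1.2, z.2.2⟩
  obtain ⟨σ, hσ, hστ⟩ := (MeasurableEmbedding.subtype_coe hS).exists_measurable_extend hτ
    fun _ => ‹Nonempty U›
  refine ⟨fun x => σ x, measurable_subtype_coe.comp hσ, fun x => (σ x).2, fun x hx u hu => ?_⟩
  have hx' : σ x = τ ⟨x, hx⟩ := congrFun hστ ⟨x, hx⟩
  simpa only [hx'] using! hmin ⟨x, hx⟩ ⟨u, hu⟩

end MeasurableSelection

section YoungMeasures

variable {α Y F : Type*} [MeasurableSpace α] {τ : Measure α} [MeasurableSpace Y]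
  [NormedAddCommGroup F]

/-- `ν` is a Young measure with base `τ` carried by `U`: a family of probability measures that
depends measurably on the parameter and is concentrated on `U` for `τ`-almost every parameter. -/
structure IsYoungMeasure (τ : Measure α) (U : Set Y) (ν : α → ProbabilityMeasure Y) : Prop where
  aemeasurable : AEMeasurable (fun t => (ν t : Measure Y)) τ
  ae_mem : ∀ᵐ t ∂τ, ∀ᵐ u ∂(ν t : Measure Y), u ∈ U

theorem aemeasurable_of_forall_measurableSet_aemeasurable [MeasurableSpace.CountablyGenerated Y]
    {ν : α → ProbabilityMeasure Y}
    (hν : ∀ s, MeasurableSet s → AEMeasurable (fun t => (ν t : Measure Y) s) τ) :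
    AEMeasurable (fun t => (ν t : Measure Y)) τ := by
  set C := generateSetAlgebra (MeasurableSpace.countableGeneratingSet Y)
  have hgen : ‹MeasurableSpace Y› = .generateFrom C := by
    rw [generateFrom_generateSetAlgebra_eq, MeasurableSpace.generateFrom_countableGeneratingSet]
  have hC : ∀ s ∈ C, MeasurableSet s := fun s hs =>
    hgen ▸ MeasurableSpace.measurableSet_generateFrom hs
  have hmk : ∀ᵐ t ∂τ, ∀ s (hs : s ∈ C), (ν t : Measure Y) s = (hν s (hC s hs)).mk _ t :=
    (ae_ball_iff (countable_generateSetAlgebra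
      (MeasurableSpace.countable_countableGeneratingSet (α := Y)))).2
      fun s hs => (hν s (hC s hs)).ae_eq_mk
  obtain ⟨S, hS, hSm, hSmk⟩ := hmk.exists_measurable_mem
  rw [← Measure.restrict_eq_self_of_ae_mem hS]
  refine aemeasurable_restrict_of_measurable_subtype hSm ?_
  refine Measurable.measure_of_isPiSystem_of_isProbabilityMeasure hgen
    isSetAlgebra_generateSetAlgebra.isSetRing.isSetSemiring.isPiSystem fun s hs => ?_
  rw [show (fun t : S => (ν t : Measure Y) s) = fun t : S => (hν s (hC s hs)).mk _ t from
    funext fun t => hSmk t t.2 s hs]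
  exact (hν s (hC s hs)).measurable_mk.comp measurable_subtype_coe

theorem integrable_of_isCompact_of_ae_mem [TopologicalSpace Y] [BorelSpace Y]
    [TopologicalSpace.PseudoMetrizableSpace Y] [SecondCountableTopology Y] [T2Space Y]
    {ρ : Measure Y} [IsFiniteMeasureOnCompacts ρ] {U : Set Y} {g : Y → F} (hU : IsCompact U)
    (hg : ContinuousOn g U) (hρ : ∀ᵐ u ∂ρ, u ∈ U) : Integrable g ρ := by
  have h := hg.integrableOn_compact (μ := ρ) hU
  rwa [IntegrableOn, Measure.restrict_eq_self_of_ae_mem hρ] at h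

namespace IsYoungMeasure

variable {U : Set Y} {ν : α → ProbabilityMeasure Y} {φ : α → Y → F}

theorem nonempty [NeZero τ] (hν : IsYoungMeasure τ U ν) : U.Nonempty := by
  obtain ⟨t, ht⟩ := hν.ae_mem.exists
  exact ht.exists

variable [NormedSpace ℝ F]

theorem ae_norm_integral_le {C : ℝ} (hν : IsYoungMeasure τ U ν)
    (hφ : ∀ᵐ t ∂τ, ∀ u ∈ U, ‖φ t u‖ ≤ C) : ∀ᵐ t ∂τ, ‖∫ u, φ t u ∂(ν t : Measure Y)‖ ≤ C := by
  filter_upwards [hν.ae_mem, hφ] with t hU ht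
  simpa using norm_integral_le_of_norm_le_const (hU.mono ht)

theorem aestronglyMeasurable_integral (hν : IsYoungMeasure τ U ν) {ψ : α × Y → F}
    (hψ : StronglyMeasurable ψ) (hφ : ∀ᵐ t ∂τ, EqOn (φ t) (fun u => ψ (t, u)) U) :
    AEStronglyMeasurable (fun t => ∫ u, φ t u ∂(ν t : Measure Y)) τ := by
  rcases isEmpty_or_nonempty α with hα | ⟨⟨t₀⟩⟩
  · exact AEStronglyMeasurable.of_subsingleton_dom
  obtain ⟨κ, hκ, hκp, hνκ⟩ := hν.aemeasurable.exists_ae_eq_range_subset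
    (t := {ρ | IsProbabilityMeasure ρ}) (ae_of_all _ fun t => (ν t).2) ⟨ν t₀, (ν t₀).2⟩
  let k : ProbabilityTheory.Kernel α Y := ⟨κ, hκ⟩
  have : ProbabilityTheory.IsMarkovKernel k := ⟨fun t => hκp ⟨t, rfl⟩⟩
  have hk : StronglyMeasurable fun t => ∫ u, ψ (t, u) ∂(k t) :=
    hψ.integral_kernel_prod_right'
  refine hk.aestronglyMeasurable.congr ?_
  filter_upwards [hνκ, hν.ae_mem, hφ] with t hνt hU hφt
  rw [show k t = ν t from hνt.symm]
  exact integral_congr_ae (hU.mono fun u hu => (hφt hu).symm)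

theorem integrableOn_integral [TopologicalSpace Y] [BorelSpace Y] [TopologicalSpace α]
    [OpensMeasurableSpace α] [T2Space α]
    [SecondCountableTopology Y] [T2Space Y] [SecondCountableTopology F]
    [IsFiniteMeasureOnCompacts τ] {K : Set α} (hK : IsCompact K) (hU : IsCompact U)
    (hν : IsYoungMeasure (τ.restrict K) U ν) (hφ : ContinuousOn (uncurry φ) (K ×ˢ U)) :
    IntegrableOn (fun t => ∫ u, φ t u ∂(ν t : Measure Y)) K τ := by
  classical
  borelize F
  have hψ : Measurable ((K ×ˢ U).piecewise (uncurry φ) fun _ => 0) :=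
    hφ.measurable_piecewise continuousOn_const (hK.measurableSet.prod hU.measurableSet)
  obtain ⟨C, hC⟩ := (hK.prod hU).exists_bound_of_continuousOn hφ
  refine IntegrableOn.of_bound hK.measure_lt_top ?_ C ?_
  · refine hν.aestronglyMeasurable_integral hψ.stronglyMeasurable ?_
    filter_upwards [ae_restrict_mem hK.measurableSet] with t ht u hu
    exact (piecewise_eq_of_mem (K ×ˢ U) (uncurry φ) _ (mk_mem_prod ht hu)).symm
  · refine hν.ae_norm_integral_le ?_
    filter_upwards [ae_restrict_mem hK.measurableSet] with t ht u hu
    exact hC (t, u) ⟨ht, hu⟩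

theorem exists_forall_ae_integral_le [TopologicalSpace α] [OpensMeasurableSpace α]
    [TopologicalSpace Y] [TopologicalSpace.MetrizableSpace Y] [SecondCountableTopology Y]
    [BorelSpace Y] {K : Set α} (hK : MeasurableSet K) (hU : IsCompact U) (hne : U.Nonempty)
    {h : α → Y → ℝ} (hh : ContinuousOn (uncurry h) (K ×ˢ U)) :
    ∃ ν, IsYoungMeasure (τ.restrict K) U ν ∧ ∀ ν', IsYoungMeasure (τ.restrict K) U ν' →
      ∀ᵐ t ∂τ.restrict K, ∫ u, h t u ∂(ν t : Measure Y) ≤ ∫ u, h t u ∂(ν' t : Measure Y) := by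
  obtain ⟨σ, hσ, hσU, hmin⟩ := exists_measurable_isMinOn_of_isCompact hK hU hne hh
  refine ⟨fun t => diracProba (σ t), ⟨(Measure.measurable_dirac.comp hσ).aemeasurable,
    ae_of_all _ fun t => (ae_dirac_iff hU.measurableSet).2 (hσU t)⟩, fun ν' hν' => ?_⟩
  filter_upwards [hν'.ae_mem, ae_restrict_mem hK] with t hUt ht
  have hcont : ContinuousOn (h t) U :=
    hh.comp (Continuous.prodMk_right t).continuousOn fun u hu => ⟨ht, hu⟩
  calc ∫ u, h t u ∂(Measure.dirac (σ t)) = ∫ _, h t (σ t) ∂(ν' t : Measure Y) := by simp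
    _ ≤ ∫ u, h t u ∂(ν' t : Measure Y) :=
      integral_mono_ae (integrable_const _) (integrable_of_isCompact_of_ae_mem hU hcont hUt)
        (hUt.mono fun u hu => hmin t ht hu)

end IsYoungMeasure

section ConvexCombination

open unitInterval

/-- The probability measure `(1 - ε) μ + ε ν`. -/
noncomputable def convexCombination (ε : I) (μ ν : ProbabilityMeasure Y) :
    ProbabilityMeasure Y :=
  ⟨toNNReal (σ ε) • (μ : Measure Y) + toNNReal ε • (ν : Measure Y), ⟨by
    rw [Measure.add_apply, Measure.smul_apply, Measure.smul_apply, measure_univ, measure_univ,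
      ← add_smul, toNNReal_symm_add_toNNReal, one_smul]⟩⟩

theorem integral_convexCombination [NormedSpace ℝ F] {ε : I} {μ ν : ProbabilityMeasure Y}
    {g : Y → F} (hμ : Integrable g μ) (hν : Integrable g ν) :
    ∫ u, g u ∂(convexCombination ε μ ν : Measure Y) =
      ∫ u, g u ∂(μ : Measure Y) +
        (ε : ℝ) • (∫ u, g u ∂(ν : Measure Y) - ∫ u, g u ∂(μ : Measure Y)) := by
  change ∫ u, g u ∂(toNNReal (σ ε) • (μ : Measure Y) + toNNReal ε • (ν : Measure Y)) = _
  rw [integral_add_measure hμ.smul_measure_nnreal hν.smul_measure_nnreal,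
    integral_smul_nnreal_measure, integral_smul_nnreal_measure]
  simp only [NNReal.smul_def, coe_toNNReal, coe_symm_eq]
  module

theorem IsYoungMeasure.convexCombination {U : Set Y} {μ ν : α → ProbabilityMeasure Y} (ε : I)
    (hμ : IsYoungMeasure τ U μ) (hν : IsYoungMeasure τ U ν) :
    IsYoungMeasure τ U fun t => convexCombination ε (μ t) (ν t) where
  aemeasurable := by
    have hsmul (c : ℝ≥0) : Measurable fun ρ : Measure Y => c • ρ :=
      Measure.measurable_of_measurable_coe _ fun s hs => (Measure.measurable_coe hs).const_smul c
    exact ((hsmul _).comp_aemeasurable hμ.aemeasurable).add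
      ((hsmul _).comp_aemeasurable hν.aemeasurable)
  ae_mem := by
    filter_upwards [hμ.ae_mem, hν.ae_mem] with t hμt hνt
    exact ae_add_measure_iff.2 ⟨Measure.ae_smul_measure hμt _, Measure.ae_smul_measure hνt _⟩

end ConvexCombination

theorem exists_probabilityMeasure_toSignedMeasure_eq {s : SignedMeasure Y} (hs : 0 ≤ s)
    (hs1 : s univ = 1) : ∃ ν : ProbabilityMeasure Y, (ν : Measure Y).toSignedMeasure = s := by
  have hs' := (VectorMeasure.le_restrict_univ_iff_le 0 s).2 hs
  refine ⟨⟨s.toMeasureOfZeroLE univ .univ hs', ⟨?_⟩⟩, s.toMeasureOfZeroLE_toSignedMeasure hs'⟩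
  rw [s.toMeasureOfZeroLE_apply hs' .univ .univ]
  simp [hs1]

end YoungMeasures

section JointContinuity

variable {T X W F : Type*} [TopologicalSpace T] [TopologicalSpace X] [TopologicalSpace W]
  [TopologicalSpace F] {G : T → X → W → F} {I : Set T} {U : Set W}

theorem continuousOn_uncurry_comp_of_continuousOn {x : T → X}
    (hG : ContinuousOn (fun q : T × X × W => G q.1 q.2.1 q.2.2) (I ×ˢ univ ×ˢ U))
    (hx : ContinuousOn x I) : ContinuousOn (uncurry fun t u => G t (x t) u) (I ×ˢ U) := by
  have hxq : ContinuousOn (fun q : T × W => (q.1, x q.1, q.2)) (I ×ˢ U) :=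
    continuousOn_fst.prodMk ((hx.comp continuousOn_fst mapsTo_fst_prod).prodMk continuousOn_snd)
  exact hG.comp hxq fun q hq => ⟨hq.1, mem_univ _, hq.2⟩

theorem continuousOn_apply_of_continuousOn
    (hG : ContinuousOn (fun q : T × X × W => G q.1 q.2.1 q.2.2) (I ×ˢ univ ×ˢ U)) {t : T}
    (ht : t ∈ I) (y : X) : ContinuousOn (G t y) U :=
  (continuousOn_uncurry_comp_of_continuousOn hG (continuousOn_const (c := y))).comp
    (Continuous.prodMk_right t).continuousOn fun _ hu => ⟨ht, hu⟩

end JointContinuity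

theorem continuousOn_of_norm_sub_le {X W F : Type*} [NormedAddCommGroup X] [NormedAddCommGroup W]
    [NormedAddCommGroup F] {G : ℝ → X → W → F} {L : ℝ} {I : Set ℝ} {U : Set W}
    (hG : ∀ t₁ ∈ I, ∀ t₂ ∈ I, ∀ x₁ x₂, ∀ u₁ ∈ U, ∀ u₂ ∈ U,
      ‖G t₁ x₁ u₁ - G t₂ x₂ u₂‖ ≤ L * (|t₁ - t₂| + ‖x₁ - x₂‖ + ‖u₁ - u₂‖)) :
    ContinuousOn (fun q : ℝ × X × W => G q.1 q.2.1 q.2.2) (I ×ˢ univ ×ˢ U) := by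
  rintro ⟨t, y, u⟩ ⟨ht, -, hu⟩
  refine tendsto_iff_norm_sub_tendsto_zero.2 ?_
  have hlim : Tendsto (fun q : ℝ × X × W => L * (|q.1 - t| + ‖q.2.1 - y‖ + ‖q.2.2 - u‖))
      (𝓝 (t, y, u)) (𝓝 0) := Continuous.tendsto' (by fun_prop) _ _ (by simp)
  refine squeeze_zero' (Eventually.of_forall fun q => norm_nonneg _) ?_
    (hlim.mono_left nhdsWithin_le_nhds)
  filter_upwards [self_mem_nhdsWithin] with q hq
  exact hG q.1 hq.1 t ht q.2.1 y q.2.2 hq.2.2 u hu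

theorem exists_forall_norm_sub_sub_fderiv_le_of_isCompact {E F β : Type*} [NormedAddCommGroup E]
    [NormedSpace ℝ E] [NormedAddCommGroup F] [NormedSpace ℝ F] [TopologicalSpace β]
    {g : E → β → F} {c : β → E} {k : Set β} (hk : IsCompact k)
    (hg : ∀ p ∈ k, Differentiable ℝ fun y => g y p)
    (hg' : ContinuousOn (uncurry fun v p => fderiv ℝ (fun y => g y p) (c p + v)) (univ ×ˢ k))
    {η : ℝ} (hη : 0 < η) :
    ∃ δ > 0, ∀ p ∈ k, ∀ y, ‖y - c p‖ ≤ δ →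
      ‖g y p - g (c p) p - fderiv ℝ (fun y => g y p) (c p) (y - c p)‖ ≤ η * ‖y - c p‖ := by
  obtain ⟨V, hV, hVk⟩ := hk.mem_uniformity_of_prod hg' (mem_univ 0) (Metric.dist_mem_uniformity hη)
  rw [nhdsWithin_univ] at hV
  obtain ⟨δ, hδ, hδV⟩ := Metric.nhds_basis_closedBall.mem_iff.1 hV
  refine ⟨δ, hδ, fun p hp y hy => ?_⟩
  refine (convex_closedBall (c p) δ).norm_image_sub_le_of_norm_fderiv_le'
    (fun z _ => hg p hp z) (fun z hz => ?_) (Metric.mem_closedBall_self hδ.le)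
    (mem_closedBall_iff_norm.2 hy)
  have h := hVk (z - c p) (hδV (by simpa [dist_eq_norm] using hz)) p hp
  rw [add_sub_cancel, add_zero] at h
  exact (dist_eq_norm _ _).symm.trans_le (le_of_lt h)

namespace ControlProblem

variable {n m : ℕ} {P : ControlProblem n m} {L : ℝ≥0}
  {μ ν : ℝ → ProbabilityMeasure (EuclideanSpace ℝ (Fin m))} {x : ℝ → EuclideanSpace ℝ (Fin n)}
  {z : Pair n m}

section RelaxedDynamics

/-- The part of the regularity of the data on which the optimality functions depend: `Ψ` and
`f(t, ·, u)` are differentiable, `f` and `∂f/∂x` are continuous on `[0,T] × ℝⁿ × U`, and `L` is a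
Lipschitz constant of all the maps `f(t, ·, u)`. -/
structure IsStateRegular (P : ControlProblem n m) (L : ℝ≥0) : Prop where
  differentiable_cost : Differentiable ℝ P.Ψ
  differentiable_state : ∀ t ∈ Icc 0 P.T, ∀ u ∈ P.U, Differentiable ℝ fun y => P.f t y u
  continuousOn_f : ContinuousOn (fun q : ℝ × EuclideanSpace ℝ (Fin n) × EuclideanSpace ℝ (Fin m) =>
    P.f q.1 q.2.1 q.2.2) (Icc 0 P.T ×ˢ univ ×ˢ P.U)
  continuousOn_dfx :
    ContinuousOn (fun q : ℝ × EuclideanSpace ℝ (Fin n) × EuclideanSpace ℝ (Fin m) =>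
      P.dfx q.1 q.2.1 q.2.2) (Icc 0 P.T ×ˢ univ ×ˢ P.U)
  lipschitzWith : ∀ t ∈ Icc 0 P.T, ∀ u ∈ P.U, LipschitzWith L fun y => P.f t y u

theorem LipschitzDifferentiable.exists_isStateRegular (hP : P.LipschitzDifferentiable) :
    ∃ L, P.IsStateRegular L := by
  obtain ⟨L, hL, -, -, hf, hfx, -⟩ := hP.lipschitz
  lift L to ℝ≥0 using hL.le
  refine ⟨L, hP.diff_cost, fun t ht u hu y => hP.diff_state t ht y u hu,
    continuousOn_of_norm_sub_le hf, continuousOn_of_norm_sub_le hfx,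
    fun t ht u hu => LipschitzWith.of_dist_le_mul fun y z => ?_⟩
  simpa only [sub_self, abs_zero, norm_zero, zero_add, add_zero, dist_eq_norm] using
    hf t ht t ht y z u hu u hu

namespace IsStateRegular

theorem norm_dfx_le (hP : P.IsStateRegular L) {t : ℝ} (ht : t ∈ Icc 0 P.T)
    (y : EuclideanSpace ℝ (Fin n)) {u : EuclideanSpace ℝ (Fin m)} (hu : u ∈ P.U) :
    ‖P.dfx t y u‖ ≤ L :=
  norm_fderiv_le_of_lipschitz ℝ (hP.lipschitzWith t ht u hu)

theorem exists_forall_norm_sub_sub_dfx_le (hP : P.IsStateRegular L) (hU : IsCompact P.U)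
    (hx : ContinuousOn x (Icc 0 P.T)) {η : ℝ} (hη : 0 < η) :
    ∃ δ > 0, ∀ t ∈ Icc 0 P.T, ∀ u ∈ P.U, ∀ y, ‖y - x t‖ ≤ δ →
      ‖P.f t y u - P.f t (x t) u - P.dfx t (x t) u (y - x t)‖ ≤ η * ‖y - x t‖ := by
  have hcont : ContinuousOn (uncurry fun (v : EuclideanSpace ℝ (Fin n))
      (q : ℝ × EuclideanSpace ℝ (Fin m)) => P.dfx q.1 (x q.1 + v) q.2)
      (univ ×ˢ Icc 0 P.T ×ˢ P.U) := by
    have hq : ContinuousOn (fun q : EuclideanSpace ℝ (Fin n) × ℝ × EuclideanSpace ℝ (Fin m) =>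
        (q.2.1, x q.2.1 + q.1, q.2.2)) (univ ×ˢ Icc 0 P.T ×ˢ P.U) := by
      have ht : Continuous fun q : EuclideanSpace ℝ (Fin n) × ℝ × EuclideanSpace ℝ (Fin m) =>
        q.2.1 := continuous_snd.fst
      exact ht.continuousOn.prodMk (((hx.comp ht.continuousOn fun q hq => hq.2.1).add
        continuousOn_fst).prodMk continuous_snd.snd.continuousOn)
    exact hP.continuousOn_dfx.comp hq fun _ hq => ⟨hq.2.1, mem_univ _, hq.2.2⟩
  obtain ⟨δ, hδ, h⟩ := exists_forall_norm_sub_sub_fderiv_le_of_isCompact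
    (g := fun y (q : ℝ × EuclideanSpace ℝ (Fin m)) => P.f q.1 y q.2) (c := fun q => x q.1)
    (isCompact_Icc.prod hU) (fun q hq => hP.differentiable_state q.1 hq.1 q.2 hq.2) hcont hη
  exact ⟨δ, hδ, fun t ht u hu => h (t, u) ⟨ht, hu⟩⟩

end IsStateRegular

/-- `ν` is a relaxed control of `P`: a measurable process on `[0,T]` of probability measures
concentrated on the input set. -/
abbrev IsControl (P : ControlProblem n m)
    (ν : ℝ → ProbabilityMeasure (EuclideanSpace ℝ (Fin m))) : Prop :=
  IsYoungMeasure (volume.restrict (Icc 0 P.T)) P.U ν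

/-- The relaxed vector field `(t, x) ↦ ∫ f(t, x, u) dν_t(u)`. -/
noncomputable def relaxedField (P : ControlProblem n m)
    (ν : ℝ → ProbabilityMeasure (EuclideanSpace ℝ (Fin m))) (t : ℝ)
    (y : EuclideanSpace ℝ (Fin n)) : EuclideanSpace ℝ (Fin n) :=
  ∫ u, P.f t y u ∂(ν t : Measure (EuclideanSpace ℝ (Fin m)))

/-- The derivative `∫ ∂f/∂x(t, x, u) dν_t(u)` of the relaxed vector field in the state. -/
noncomputable def relaxedDeriv (P : ControlProblem n m)
    (ν : ℝ → ProbabilityMeasure (EuclideanSpace ℝ (Fin m))) (t : ℝ)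
    (y : EuclideanSpace ℝ (Fin n)) : EuclideanSpace ℝ (Fin n) →L[ℝ] EuclideanSpace ℝ (Fin n) :=
  ∫ u, P.dfx t y u ∂(ν t : Measure (EuclideanSpace ℝ (Fin m)))

theorem isFeasible_iff (hU : IsClosed P.U) : P.IsFeasible z ↔
    P.IsControl z.2 ∧ IsCaratheodorySolution (P.relaxedField z.2) 0 P.T 0 P.ξ z.1 := by
  have hsupp (ρ : Measure (EuclideanSpace ℝ (Fin m))) : ρ.support ⊆ P.U ↔ ∀ᵐ u ∂ρ, u ∈ P.U :=
    ⟨fun h => mem_of_superset Measure.support_mem_ae h,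
      fun h => Measure.support_subset_of_isClosed hU h⟩
  exact ⟨fun h => ⟨⟨h.measurable, h.support.mono fun t ht => (hsupp _).1 ht⟩,
      ⟨h.integrable, h.trajectory⟩⟩,
    fun h => ⟨h.1.aemeasurable, h.1.ae_mem.mono fun t ht => (hsupp _).2 ht,
      h.2.intervalIntegrable, h.2.eq_picard⟩⟩

theorem IsControl.intervalIntegrable_integral {F : Type*} [NormedAddCommGroup F] [NormedSpace ℝ F]
    [SecondCountableTopology F] {φ : ℝ → EuclideanSpace ℝ (Fin m) → F} (hν : P.IsControl ν)
    (hT : 0 ≤ P.T) (hU : IsCompact P.U)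
    (hφ : ContinuousOn (uncurry φ) (Icc 0 P.T ×ˢ P.U)) :
    IntervalIntegrable (fun t => ∫ u, φ t u ∂(ν t : Measure (EuclideanSpace ℝ (Fin m))))
      volume 0 P.T :=
  (intervalIntegrable_iff_integrableOn_Icc_of_le hT).2
    (hν.integrableOn_integral isCompact_Icc hU hφ)

namespace IsStateRegular

theorem ae_integrable_f (hP : P.IsStateRegular L) (hU : IsCompact P.U) (hν : P.IsControl ν) :
    ∀ᵐ t ∂volume.restrict (Icc 0 P.T), ∀ y,
      Integrable (P.f t y) (ν t : Measure (EuclideanSpace ℝ (Fin m))) := by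
  filter_upwards [hν.ae_mem, ae_restrict_mem measurableSet_Icc] with t hνt ht y
  exact integrable_of_isCompact_of_ae_mem hU
    (continuousOn_apply_of_continuousOn hP.continuousOn_f ht y) hνt

theorem ae_lipschitzWith_relaxedField (hP : P.IsStateRegular L) (hU : IsCompact P.U)
    (hν : P.IsControl ν) :
    ∀ᵐ t ∂volume.restrict (Icc 0 P.T), LipschitzWith L (P.relaxedField ν t) := by
  filter_upwards [hP.ae_integrable_f hU hν, hν.ae_mem, ae_restrict_mem measurableSet_Icc]
    with t hint hνt ht
  refine LipschitzWith.of_dist_le_mul fun y z => ?_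
  rw [dist_eq_norm, dist_eq_norm, relaxedField, relaxedField, ← integral_sub (hint y) (hint z)]
  have hle := norm_integral_le_of_norm_le_const (hνt.mono fun u hu =>
    (hP.lipschitzWith t ht u hu).norm_sub_le y z)
  simpa only [probReal_univ, mul_one] using hle

theorem isLipschitzCaratheodory_relaxedField (hP : P.IsStateRegular L) (hT : 0 ≤ P.T)
    (hU : IsCompact P.U) (hν : P.IsControl ν) :
    IsLipschitzCaratheodory (P.relaxedField ν) L 0 P.T where
  intervalIntegrable_comp hx := hν.intervalIntegrable_integral hT hU
    (continuousOn_uncurry_comp_of_continuousOn hP.continuousOn_f hx)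
  ae_lipschitzWith := hP.ae_lipschitzWith_relaxedField hU hν

theorem intervalIntegrable_relaxedDeriv (hP : P.IsStateRegular L) (hT : 0 ≤ P.T)
    (hU : IsCompact P.U) (hν : P.IsControl ν) (hx : ContinuousOn x (Icc 0 P.T)) :
    IntervalIntegrable (fun t => P.relaxedDeriv ν t (x t)) volume 0 P.T :=
  hν.intervalIntegrable_integral hT hU
    (continuousOn_uncurry_comp_of_continuousOn hP.continuousOn_dfx hx)

theorem ae_norm_relaxedDeriv_le (hP : P.IsStateRegular L) (hν : P.IsControl ν)
    (x : ℝ → EuclideanSpace ℝ (Fin n)) :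
    ∀ᵐ t ∂volume.restrict (Icc 0 P.T), ‖P.relaxedDeriv ν t (x t)‖ ≤ L := by
  refine hν.ae_norm_integral_le ?_
  filter_upwards [ae_restrict_mem measurableSet_Icc] with t ht u hu
  exact hP.norm_dfx_le ht (x t) hu

theorem exists_forall_ae_norm_sub_sub_relaxedDeriv_le (hP : P.IsStateRegular L)
    (hU : IsCompact P.U) (hν : P.IsControl ν) (hx : ContinuousOn x (Icc 0 P.T)) {η : ℝ}
    (hη : 0 < η) :
    ∃ δ > 0, ∀ᵐ t ∂volume.restrict (Icc 0 P.T), ∀ y, ‖y - x t‖ ≤ δ →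
      ‖P.relaxedField ν t y - P.relaxedField ν t (x t) - P.relaxedDeriv ν t (x t) (y - x t)‖ ≤
        η * ‖y - x t‖ := by
  obtain ⟨δ, hδ, hδη⟩ := hP.exists_forall_norm_sub_sub_dfx_le hU hx hη
  refine ⟨δ, hδ, ?_⟩
  filter_upwards [hP.ae_integrable_f hU hν, hν.ae_mem, ae_restrict_mem measurableSet_Icc]
    with t hf hνt ht y hy
  have hdfx := integrable_of_isCompact_of_ae_mem hU
    (continuousOn_apply_of_continuousOn hP.continuousOn_dfx ht (x t)) hνt
  rw [relaxedField, relaxedField, relaxedDeriv, ContinuousLinearMap.integral_apply hdfx,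
    ← integral_sub' (hf y) (hf (x t)),
    ← integral_sub ((hf y).sub (hf (x t))) (hdfx.apply_continuousLinearMap _)]
  have hle := norm_integral_le_of_norm_le_const (hνt.mono fun u hu => hδη t ht u hu y hy)
  simpa only [Pi.sub_apply, probReal_univ, mul_one] using hle

theorem ae_relaxedField_convexCombination (hP : P.IsStateRegular L) (hU : IsCompact P.U)
    (hμ : P.IsControl μ) (hν : P.IsControl ν) (ε : unitInterval) :
    ∀ᵐ t ∂volume.restrict (Icc 0 P.T), ∀ y,
      P.relaxedField (fun t => convexCombination ε (μ t) (ν t)) t y =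
        P.relaxedField μ t y + (ε : ℝ) • (P.relaxedField ν t y - P.relaxedField μ t y) := by
  filter_upwards [hP.ae_integrable_f hU hμ, hP.ae_integrable_f hU hν] with t hμt hνt y
  exact integral_convexCombination (hμt y) (hνt y)

end IsStateRegular

end RelaxedDynamics

section Variations

variable {δμ : ℝ → SignedMeasure (EuclideanSpace ℝ (Fin m))}

/-- The process `ν - μ` of signed measures, the variation that leads from the control `μ` to the
control `ν`. -/
noncomputable def diffProcess (ν μ : ℝ → ProbabilityMeasure (EuclideanSpace ℝ (Fin m))) (t : ℝ) :
    SignedMeasure (EuclideanSpace ℝ (Fin m)) :=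
  (ν t : Measure (EuclideanSpace ℝ (Fin m))).toSignedMeasure -
    (μ t : Measure (EuclideanSpace ℝ (Fin m))).toSignedMeasure

theorem IsControl.aemeasurable_real (hν : P.IsControl ν) {s : Set (EuclideanSpace ℝ (Fin m))}
    (hs : MeasurableSet s) :
    AEMeasurable (fun t => (ν t : Measure (EuclideanSpace ℝ (Fin m))).real s)
      (volume.restrict (Icc 0 P.T)) :=
  ((Measure.measurable_coe hs).comp_aemeasurable hν.aemeasurable).ennreal_toReal

theorem IsControl.isAdmissibleVariation (hν : P.IsControl ν) (hμ : P.IsControl μ)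
    (hU : IsClosed P.U) : P.IsAdmissibleVariation μ (diffProcess ν μ) where
  measurable s hs := by
    simp only [diffProcess, Measure.toSignedMeasure_sub_apply hs]
    exact (hν.aemeasurable_real hs).sub (hμ.aemeasurable_real hs)
  support := by
    filter_upwards [hν.ae_mem] with t ht
    rw [diffProcess, sub_add_cancel, Measure.variation_toSignedMeasure]
    exact Measure.support_subset_of_isClosed hU ht
  nonneg := ae_of_all _ fun t => by
    rw [diffProcess, sub_add_cancel]
    exact Measure.zero_le_toSignedMeasure _
  mass := ae_of_all _ fun t => by
    rw [diffProcess, Measure.toSignedMeasure_sub_apply .univ, probReal_univ, probReal_univ,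
      sub_self]

theorem IsAdmissibleVariation.ae_exists_toSignedMeasure_eq (h : P.IsAdmissibleVariation μ δμ) :
    ∀ᵐ t ∂volume.restrict (Icc 0 P.T), ∃ ρ : ProbabilityMeasure (EuclideanSpace ℝ (Fin m)),
      (ρ : Measure (EuclideanSpace ℝ (Fin m))).toSignedMeasure =
        δμ t + (μ t : Measure (EuclideanSpace ℝ (Fin m))).toSignedMeasure := by
  filter_upwards [h.nonneg, h.mass] with t hnonneg hmass
  refine exists_probabilityMeasure_toSignedMeasure_eq hnonneg ?_
  rw [add_apply, hmass, Measure.toSignedMeasure_apply_measurable .univ, probReal_univ, zero_add]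

theorem IsAdmissibleVariation.exists_isControl (h : P.IsAdmissibleVariation μ δμ)
    (hμ : P.IsControl μ) :
    ∃ ν, P.IsControl ν ∧ δμ =ᵐ[volume.restrict (Icc 0 P.T)] diffProcess ν μ := by
  have : Nonempty (ProbabilityMeasure (EuclideanSpace ℝ (Fin m))) := ⟨μ 0⟩
  let ν t := Classical.epsilon fun ρ : ProbabilityMeasure (EuclideanSpace ℝ (Fin m)) =>
    (ρ : Measure (EuclideanSpace ℝ (Fin m))).toSignedMeasure =
      δμ t + (μ t : Measure (EuclideanSpace ℝ (Fin m))).toSignedMeasure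
  have hν : ∀ᵐ t ∂volume.restrict (Icc 0 P.T),
      (ν t : Measure (EuclideanSpace ℝ (Fin m))).toSignedMeasure =
        δμ t + (μ t : Measure (EuclideanSpace ℝ (Fin m))).toSignedMeasure :=
    h.ae_exists_toSignedMeasure_eq.mono fun _ ht => Classical.epsilon_spec ht
  refine ⟨ν, ⟨aemeasurable_of_forall_measurableSet_aemeasurable fun s hs => ?_, ?_⟩, ?_⟩
  · refine ((h.measurable s hs).add (hμ.aemeasurable_real hs)).ennreal_ofReal.congr ?_
    filter_upwards [hν] with t ht
    rw [Pi.add_apply, ← Measure.toSignedMeasure_apply_measurable hs, ← add_apply, ← ht,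
      Measure.toSignedMeasure_apply_measurable hs, ofReal_measureReal]
  · filter_upwards [hν, h.support] with t ht hsupp
    rw [← ht, Measure.variation_toSignedMeasure] at hsupp
    exact mem_of_superset Measure.support_mem_ae hsupp
  · filter_upwards [hν] with t ht
    rw [diffProcess, ht, add_sub_cancel_right]

theorem integral_diffProcess {F : Type*} [NormedAddCommGroup F] [NormedSpace ℝ F]
    {g : EuclideanSpace ℝ (Fin m) → F} {t : ℝ}
    (hν : Integrable g (ν t : Measure (EuclideanSpace ℝ (Fin m))))
    (hμ : Integrable g (μ t : Measure (EuclideanSpace ℝ (Fin m)))) :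
    ∫ᵛ u, g u ∂<•(diffProcess ν μ t) =
      ∫ u, g u ∂(ν t : Measure (EuclideanSpace ℝ (Fin m))) -
        ∫ u, g u ∂(μ t : Measure (EuclideanSpace ℝ (Fin m))) := by
  rw [diffProcess, VectorMeasure.integral_sub_vectorMeasure, VectorMeasure.integral_toSignedMeasure,
    VectorMeasure.integral_toSignedMeasure]
  all_goals rwa [VectorMeasure.Integrable, Measure.variation_toSignedMeasure]

theorem IsStateRegular.ae_integral_f_eq_sub (hP : P.IsStateRegular L) (hU : IsCompact P.U)
    (hν : P.IsControl ν) (hμ : P.IsControl μ)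
    (hδ : δμ =ᵐ[volume.restrict (Icc 0 P.T)] diffProcess ν μ) :
    ∀ᵐ t ∂volume.restrict (Icc 0 P.T), ∀ y,
      ∫ᵛ u, P.f t y u ∂<•(δμ t) = P.relaxedField ν t y - P.relaxedField μ t y := by
  filter_upwards [hδ, hP.ae_integrable_f hU hν, hP.ae_integrable_f hU hμ] with t ht hνt hμt y
  rw [ht, integral_diffProcess (hνt y) (hμt y), relaxedField, relaxedField]

end Variations

section Costate

variable {p q : ℝ → EuclideanSpace ℝ (Fin n)}

theorem adjointField_eq (z : Pair n m) (p : ℝ → EuclideanSpace ℝ (Fin n)) (s : ℝ) :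
    P.adjointField z p s =
      ContinuousLinearMap.adjoint (P.relaxedDeriv z.2 s (z.1 s)) (p s) := by
  rw [adjointField, integral_adjoint, relaxedDeriv]

theorem isCostate_iff : P.IsCostate z p ↔ IsCaratheodorySolution
    (fun s y => -ContinuousLinearMap.adjoint (P.relaxedDeriv z.2 s (z.1 s)) y) 0 P.T P.T
      (gradient P.Ψ (z.1 P.T)) p := by
  have hpicard (t : ℝ) : ODE.picard
      (fun s y => -ContinuousLinearMap.adjoint (P.relaxedDeriv z.2 s (z.1 s)) y) P.T
        (gradient P.Ψ (z.1 P.T)) p t =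
      gradient P.Ψ (z.1 P.T) + ∫ s in t..P.T, P.adjointField z p s := by
    simp only [ODE.picard, intervalIntegral.integral_neg, ← adjointField_eq,
      intervalIntegral.integral_symm t P.T, neg_neg]
  refine ⟨fun h => ⟨?_, fun t ht => (h.costate t ht).trans (hpicard t).symm⟩,
    fun h => ⟨?_, fun t ht => (h.eq_picard ht).trans (hpicard t)⟩⟩
  · simpa only [← adjointField_eq, Pi.neg_def] using h.integrable.neg
  · simpa only [← adjointField_eq, Pi.neg_def, neg_neg] using h.intervalIntegrable.neg

theorem IsStateRegular.isLipschitzCaratheodory_adjoint (hP : P.IsStateRegular L) (hT : 0 ≤ P.T)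
    (hU : IsCompact P.U) (hμ : P.IsControl μ) (hx : ContinuousOn x (Icc 0 P.T)) :
    IsLipschitzCaratheodory
      (fun s y => -ContinuousLinearMap.adjoint (P.relaxedDeriv μ s (x s)) y) L 0 P.T := by
  have hA : IntervalIntegrable
      (fun s => -ContinuousLinearMap.adjoint (P.relaxedDeriv μ s (x s))) volume 0 P.T := by
    have h := hμ.intervalIntegrable_integral hT hU
      (φ := fun s u => ContinuousLinearMap.adjoint (P.dfx s (x s) u)) <|
      ContinuousLinearMap.adjoint.continuous.comp_continuousOn
        (continuousOn_uncurry_comp_of_continuousOn hP.continuousOn_dfx hx)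
    simp only [relaxedDeriv, ← integral_adjoint]
    exact h.neg
  have hAL : ∀ᵐ s ∂volume.restrict (Icc 0 P.T),
      ‖-ContinuousLinearMap.adjoint (P.relaxedDeriv μ s (x s))‖ ≤ L := by
    filter_upwards [hP.ae_norm_relaxedDeriv_le hμ x] with s hs
    rwa [norm_neg, LinearIsometryEquiv.norm_map]
  simpa only [add_zero, neg_apply] using
    isLipschitzCaratheodory_affine hT hA hAL (c := fun _ => 0) intervalIntegrable_const

theorem IsStateRegular.isCostate_costate (hP : P.IsStateRegular L) (hT : 0 ≤ P.T)
    (hU : IsCompact P.U) (hμ : P.IsControl z.2) (hx : ContinuousOn z.1 (Icc 0 P.T)) :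
    P.IsCostate z (P.costate z) := by
  have h : ∃ p, P.IsCostate z p := by
    simpa only [isCostate_iff] using
      (hP.isLipschitzCaratheodory_adjoint hT hU hμ hx).exists_isCaratheodorySolution
        (right_mem_Icc.2 hT) _
  rw [costate, dif_pos h]
  exact h.choose_spec

theorem IsStateRegular.eqOn_of_isCostate (hP : P.IsStateRegular L) (hT : 0 ≤ P.T)
    (hU : IsCompact P.U) (hμ : P.IsControl z.2) (hx : ContinuousOn z.1 (Icc 0 P.T))
    (hp : P.IsCostate z p) (hq : P.IsCostate z q) : EqOn p q (Icc 0 P.T) :=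
  (hP.isLipschitzCaratheodory_adjoint hT hU hμ hx).eqOn_of_isCaratheodorySolution
    (right_mem_Icc.2 hT) (isCostate_iff.1 hp) (isCostate_iff.1 hq)

end Costate

section LinearizedValues

variable {δμ : ℝ → SignedMeasure (EuclideanSpace ℝ (Fin m))}
  {δx p : ℝ → EuclideanSpace ℝ (Fin n)} {v : ℝ}

theorem isLinearizedTrajectory_iff : P.IsLinearizedTrajectory z δμ δx ↔ IsCaratheodorySolution
    (fun s y => P.relaxedDeriv z.2 s (z.1 s) y + ∫ᵛ u, P.f s (z.1 s) u ∂<•(δμ s)) 0 P.T 0 0 δx :=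
  ⟨fun h => ⟨h.integrable, fun t ht => (h.trajectory t ht).trans (zero_add _).symm⟩,
    fun h => ⟨h.intervalIntegrable, fun _ ht => (h.eq_picard ht).trans (zero_add _)⟩⟩

theorem IsLinearizedTrajectory.fderiv_cost_eq (hδx : P.IsLinearizedTrajectory z δμ δx)
    (hT : 0 ≤ P.T) (hp : P.IsCostate z p) :
    fderiv ℝ P.Ψ (z.1 P.T) (δx P.T) = ∫ t in 0..P.T, P.hamiltonian t (z.1 t) (δμ t) (p t) := by
  rw [← inner_gradient_left, ← integral_inner_sub_inner_of_eq_integral hT hδx.integrable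
    hp.integrable hδx.trajectory hp.costate]
  refine intervalIntegral.integral_congr fun _ _ => ?_
  simp only [adjointField_eq, ContinuousLinearMap.adjoint_inner_left, linearizedField,
    inner_add_right, hamiltonian, relaxedDeriv, add_sub_cancel_left]

theorem IsStateRegular.exists_isLinearizedTrajectory (hP : P.IsStateRegular L) (hT : 0 ≤ P.T)
    (hU : IsCompact P.U) (hμ : P.IsControl z.2) (hx : ContinuousOn z.1 (Icc 0 P.T))
    (hδμ : P.IsAdmissibleVariation z.2 δμ) : ∃ δx, P.IsLinearizedTrajectory z δμ δx := by
  obtain ⟨ν, hν, hδν⟩ := hδμ.exists_isControl hμ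
  have hdiff : IntervalIntegrable
      (fun s => P.relaxedField ν s (z.1 s) - P.relaxedField z.2 s (z.1 s)) volume 0 P.T :=
    ((hP.isLipschitzCaratheodory_relaxedField hT hU hν).intervalIntegrable_comp hx).sub
      ((hP.isLipschitzCaratheodory_relaxedField hT hU hμ).intervalIntegrable_comp hx)
  have hforcing : IntervalIntegrable (fun s => ∫ᵛ u, P.f s (z.1 s) u ∂<•(δμ s)) volume 0 P.T := by
    refine hdiff.congr_ae ?_
    rw [uIoc_of_le hT]
    filter_upwards [ae_restrict_of_ae_restrict_of_subset Ioc_subset_Icc_self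
      (hP.ae_integral_f_eq_sub hU hν hμ hδν)] with s hs
    exact (hs _).symm
  simpa only [isLinearizedTrajectory_iff] using
    (isLipschitzCaratheodory_affine hT (hP.intervalIntegrable_relaxedDeriv hT hU hμ hx)
      (hP.ae_norm_relaxedDeriv_le hμ z.1) hforcing).exists_isCaratheodorySolution
      (left_mem_Icc.2 hT) 0

theorem IsStateRegular.valuesL_eq_valuesH (hP : P.IsStateRegular L) (hT : 0 ≤ P.T)
    (hU : IsCompact P.U) (hμ : P.IsControl z.2) (hx : ContinuousOn z.1 (Icc 0 P.T)) :
    P.valuesL z = P.valuesH z := by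
  have hp := hP.isCostate_costate hT hU hμ hx
  ext v
  constructor
  · rintro ⟨δx, δμ, hδμ, hδx, rfl⟩
    exact ⟨δμ, hδμ, hδx.fderiv_cost_eq hT hp⟩
  · rintro ⟨δμ, hδμ, rfl⟩
    obtain ⟨δx, hδx⟩ := hP.exists_isLinearizedTrajectory hT hU hμ hx hδμ
    exact ⟨δx, δμ, hδμ, hδx, (hδx.fderiv_cost_eq hT hp).symm⟩

theorem IsStateRegular.mem_valuesH_iff (hP : P.IsStateRegular L) (hT : 0 ≤ P.T)
    (hU : IsCompact P.U) (hμ : P.IsControl z.2) :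
    v ∈ P.valuesH z ↔ ∃ ν, P.IsControl ν ∧ v = ∫ t in 0..P.T,
      ⟪P.costate z t, P.relaxedField ν t (z.1 t) - P.relaxedField z.2 t (z.1 t)⟫_ℝ := by
  have hcongr {δμ ν} (hν : P.IsControl ν)
      (hδν : δμ =ᵐ[volume.restrict (Icc 0 P.T)] diffProcess ν z.2) :
      ∫ t in 0..P.T, P.hamiltonian t (z.1 t) (δμ t) (P.costate z t) = ∫ t in 0..P.T,
        ⟪P.costate z t, P.relaxedField ν t (z.1 t) - P.relaxedField z.2 t (z.1 t)⟫_ℝ := by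
    refine intervalIntegral.integral_congr_ae_restrict ?_
    rw [uIoc_of_le hT]
    filter_upwards [ae_restrict_of_ae_restrict_of_subset Ioc_subset_Icc_self
      (hP.ae_integral_f_eq_sub hU hν hμ hδν)] with t ht
    rw [hamiltonian, ht]
  constructor
  · rintro ⟨δμ, hδμ, rfl⟩
    obtain ⟨ν, hν, hδν⟩ := hδμ.exists_isControl hμ
    exact ⟨ν, hν, hcongr hν hδν⟩
  · rintro ⟨ν, hν, rfl⟩
    exact ⟨_, hν.isAdmissibleVariation hμ hU.isClosed, (hcongr hν .rfl).symm⟩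

theorem IsStateRegular.zero_mem_valuesH (hP : P.IsStateRegular L) (hT : 0 ≤ P.T)
    (hU : IsCompact P.U) (hμ : P.IsControl z.2) : 0 ∈ P.valuesH z :=
  (hP.mem_valuesH_iff hT hU hμ).2 ⟨z.2, hμ, by
    simp only [sub_self, inner_zero_right, intervalIntegral.integral_zero]⟩

theorem IsStateRegular.exists_isLeast_valuesH (hP : P.IsStateRegular L) (hT : 0 < P.T)
    (hU : IsCompact P.U) (hμ : P.IsControl z.2) (hx : ContinuousOn z.1 (Icc 0 P.T)) :
    ∃ v, IsLeast (P.valuesH z) v := by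
  have : NeZero (volume.restrict (Icc 0 P.T)) := ⟨by simp [hT]⟩
  have hp : ContinuousOn (P.costate z) (Icc 0 P.T) :=
    (isCostate_iff.1 (hP.isCostate_costate hT.le hU hμ hx)).continuousOn (right_mem_Icc.2 hT.le)
  have hpf : ContinuousOn (uncurry fun t u => ⟪P.costate z t, P.f t (z.1 t) u⟫_ℝ)
      (Icc 0 P.T ×ˢ P.U) :=
    (hp.comp continuousOn_fst mapsTo_fst_prod).inner
      (continuousOn_uncurry_comp_of_continuousOn hP.continuousOn_f hx)
  obtain ⟨ν, hν, hmin⟩ :=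
    IsYoungMeasure.exists_forall_ae_integral_le measurableSet_Icc hU hμ.nonempty hpf
  refine ⟨_, (hP.mem_valuesH_iff hT.le hU hμ).2 ⟨ν, hν, rfl⟩, ?_⟩
  intro v hv
  obtain ⟨ν', hν', rfl⟩ := (hP.mem_valuesH_iff hT.le hU hμ).1 hv
  have hint {ρ} (hρ : P.IsControl ρ) : IntervalIntegrable (fun t =>
      ⟪P.costate z t, P.relaxedField ρ t (z.1 t) - P.relaxedField z.2 t (z.1 t)⟫_ℝ)
        volume 0 P.T :=
    intervalIntegrable_inner_of_continuousOn hT.le hp <|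
      ((hP.isLipschitzCaratheodory_relaxedField hT.le hU hρ).intervalIntegrable_comp hx).sub
        ((hP.isLipschitzCaratheodory_relaxedField hT.le hU hμ).intervalIntegrable_comp hx)
  refine intervalIntegral.integral_mono_ae_restrict hT.le (hint hν) (hint hν') ?_
  filter_upwards [hmin ν' hν', hP.ae_integrable_f hU hν, hP.ae_integrable_f hU hν']
    with t ht hνt hνt'
  rw [integral_inner (hνt _), integral_inner (hνt' _)] at ht
  simpa only [inner_sub_right, relaxedField] using sub_le_sub_right ht _

theorem IsStateRegular.isLeast_thetaH (hP : P.IsStateRegular L) (hT : 0 < P.T)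
    (hU : IsCompact P.U) (hμ : P.IsControl z.2) (hx : ContinuousOn z.1 (Icc 0 P.T)) :
    IsLeast (P.valuesH z) (P.thetaH z) := by
  obtain ⟨v, hv⟩ := hP.exists_isLeast_valuesH hT hU hμ hx
  rwa [thetaH, hv.csInf_eq]

end LinearizedValues

section Optimality

variable {δμ : ℝ → SignedMeasure (EuclideanSpace ℝ (Fin m))} {δx : ℝ → EuclideanSpace ℝ (Fin n)}

theorem IsStateRegular.exists_ae_norm_relaxedField_le (hP : P.IsStateRegular L)
    (hU : IsCompact P.U) (hx : ContinuousOn x (Icc 0 P.T)) :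
    ∃ C, 0 ≤ C ∧ ∀ ν, P.IsControl ν →
      ∀ᵐ t ∂volume.restrict (Icc 0 P.T), ‖P.relaxedField ν t (x t)‖ ≤ C := by
  obtain ⟨C, hC⟩ := (isCompact_Icc.prod hU).exists_bound_of_continuousOn
    (continuousOn_uncurry_comp_of_continuousOn hP.continuousOn_f hx)
  refine ⟨max C 0, le_max_right _ _, fun ν hν => hν.ae_norm_integral_le ?_⟩
  filter_upwards [ae_restrict_mem measurableSet_Icc] with t ht u hu
  exact (hC (t, u) ⟨ht, hu⟩).trans (le_max_left _ _)

theorem IsStateRegular.exists_forall_isCaratheodorySolution_convexCombination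
    (hP : P.IsStateRegular L) (hT : 0 ≤ P.T) (hU : IsCompact P.U) (hμ : P.IsControl μ)
    (hν : P.IsControl ν) :
    ∃ X : ℝ → Pair n m, ∀ ε ∈ Icc (0 : ℝ) 1, P.IsFeasible (X ε) ∧ IsCaratheodorySolution
      (fun t y => P.relaxedField μ t y + ε • (P.relaxedField ν t y - P.relaxedField μ t y))
      0 P.T 0 P.ξ (X ε).1 := by
  have hex (ε : unitInterval) := (hP.isLipschitzCaratheodory_relaxedField hT hU
    (hμ.convexCombination ε hν)).exists_isCaratheodorySolution (left_mem_Icc.2 hT) P.ξ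
  choose Y hY using hex
  refine ⟨IccExtend zero_le_one fun ε => (Y ε, fun t => convexCombination ε (μ t) (ν t)),
    fun ε hε => ?_⟩
  rw [IccExtend_of_mem _ _ hε]
  exact ⟨(isFeasible_iff hU.isClosed).2 ⟨hμ.convexCombination _ hν, hY _⟩,
    (hY _).congr_ae (left_mem_Icc.2 hT) <|
      (hP.ae_relaxedField_convexCombination hU hμ hν _).mono fun t ht => ht _⟩

theorem IsStateRegular.exists_feasible_hasDerivWithinAt (hP : P.IsStateRegular L) (hT : 0 ≤ P.T)
    (hU : IsCompact P.U) (hz : P.IsFeasible z) (hδμ : P.IsAdmissibleVariation z.2 δμ)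
    (hδx : P.IsLinearizedTrajectory z δμ δx) :
    ∃ X : ℝ → Pair n m, (∀ ε ∈ Icc (0 : ℝ) 1, P.IsFeasible (X ε)) ∧ (X 0).1 P.T = z.1 P.T ∧
      HasDerivWithinAt (fun ε => (X ε).1 P.T) (δx P.T) (Icc 0 1) 0 := by
  obtain ⟨hμ, hsol⟩ := (isFeasible_iff hU.isClosed).1 hz
  have h0 : (0 : ℝ) ∈ Icc 0 P.T := left_mem_Icc.2 hT
  have hx := hsol.continuousOn h0
  obtain ⟨ν, hν, hδν⟩ := hδμ.exists_isControl hμ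
  obtain ⟨X, hX⟩ := hP.exists_forall_isCaratheodorySolution_convexCombination hT hU hμ hν
  obtain ⟨C, hC₀, hC⟩ := hP.exists_ae_norm_relaxedField_le hU hx
  have hw : IsCaratheodorySolution (fun t y => P.relaxedDeriv z.2 t (z.1 t) y +
      (P.relaxedField ν t (z.1 t) - P.relaxedField z.2 t (z.1 t))) 0 P.T 0 0 δx := by
    refine (isLinearizedTrajectory_iff.1 hδx).congr_ae h0 ?_
    filter_upwards [hP.ae_integral_f_eq_sub hU hν hμ hδν] with t ht
    rw [ht]
  have hLip := hP.ae_lipschitzWith_relaxedField hU hμ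
  have hD : ∀ᵐ t ∂volume.restrict (Icc 0 P.T),
      LipschitzWith (L + L) fun y => P.relaxedField ν t y - P.relaxedField z.2 t y := by
    filter_upwards [hP.ae_lipschitzWith_relaxedField hU hν, hLip] with t hνt hμt
    exact hνt.sub hμt
  have hB : ∀ᵐ t ∂volume.restrict (Icc 0 P.T),
      ‖P.relaxedField ν t (z.1 t) - P.relaxedField z.2 t (z.1 t)‖ ≤ C + C := by
    filter_upwards [hC ν hν, hC z.2 hμ] with t hνt hμt
    exact norm_sub_le_of_le hνt hμt
  have hX0 : IsCaratheodorySolution (P.relaxedField z.2) 0 P.T 0 P.ξ (X 0).1 := by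
    simpa only [zero_smul, add_zero] using (hX 0 (left_mem_Icc.2 zero_le_one)).2
  exact ⟨X, fun ε hε => (hX ε hε).1,
    (hP.isLipschitzCaratheodory_relaxedField hT hU hμ).eqOn_of_isCaratheodorySolution h0 hX0 hsol
      (right_mem_Icc.2 hT),
    IsCaratheodorySolution.hasDerivWithinAt_of_perturbation hT hsol (fun ε hε => (hX ε hε).2) hw
      hLip (hP.ae_norm_relaxedDeriv_le hμ z.1)
      (fun η hη => hP.exists_forall_ae_norm_sub_sub_relaxedDeriv_le hU hμ hx hη) hD
      (add_nonneg hC₀ hC₀) hB⟩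

theorem IsStateRegular.nonneg_of_mem_valuesL (hP : P.IsStateRegular L) (hT : 0 ≤ P.T)
    (hU : IsCompact P.U) (hz : P.IsFeasible z) (hmin : IsMinOn P.cost P.feasibleSet z) {v : ℝ}
    (hv : v ∈ P.valuesL z) : 0 ≤ v := by
  obtain ⟨δx, δμ, hδμ, hδx, rfl⟩ := hv
  obtain ⟨X, hX, hX0, hderiv⟩ := hP.exists_feasible_hasDerivWithinAt hT hU hz hδμ hδx
  have hcost : HasDerivWithinAt (fun ε => P.Ψ ((X ε).1 P.T))
      (fderiv ℝ P.Ψ (z.1 P.T) (δx P.T)) (Icc 0 1) 0 :=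
    HasFDerivAt.comp_hasDerivWithinAt (f := fun ε => (X ε).1 P.T) (0 : ℝ)
      (hX0 ▸ (hP.differentiable_cost (z.1 P.T)).hasFDerivAt) hderiv
  have hlocal : IsMinOn (fun ε => P.Ψ ((X ε).1 P.T)) (Icc 0 1) 0 := fun ε hε =>
    (congrArg P.Ψ hX0).trans_le (hmin (hX ε hε))
  have hcone : (1 : ℝ) ∈ posTangentConeAt (Icc (0 : ℝ) 1) 0 :=
    mem_posTangentConeAt_of_segment_subset (by rw [zero_add, segment_eq_Icc zero_le_one])
  simpa only [ContinuousLinearMap.toSpanSingleton_apply, one_smul] using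
    hlocal.localize.hasFDerivWithinAt_nonneg hcost.hasFDerivWithinAt hcone

end Optimality
end ControlProblem

theorem isOptimalityFunction_of_isLeast {X : Type*} {S : Set X} {J θ : X → ℝ} {V : X → Set ℝ}
    (hθ : ∀ z ∈ S, IsLeast (V z) (θ z)) (hzero : ∀ z ∈ S, 0 ∈ V z)
    (hmin : ∀ z ∈ S, IsMinOn J S z → ∀ v ∈ V z, 0 ≤ v) : IsOptimalityFunction S J θ :=
  have hle (z) (hz : z ∈ S) : θ z ≤ 0 := (hθ z hz).2 (hzero z hz)
  ⟨hle, fun z hz hJ => (hle z hz).antisymm (hmin z hz hJ _ (hθ z hz).1)⟩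

theorem mainTheorem5_general {n m : ℕ} (P : ControlProblem n m) {L : ℝ≥0} (hT : 0 < P.T)
    (hU : IsCompact P.U) (hP : P.IsStateRegular L) :
    (∀ z ∈ P.feasibleSet,
      (P.IsCostate z (P.costate z) ∧
        ∀ q, P.IsCostate z q → EqOn q (P.costate z) (Icc 0 P.T)) ∧
      IsLeast (P.valuesL z) (P.thetaL z) ∧
      IsLeast (P.valuesH z) (P.thetaH z)) ∧
    IsOptimalityFunction P.feasibleSet P.cost P.thetaL ∧
    IsOptimalityFunction P.feasibleSet P.cost P.thetaH := by
  have hμ (z) (hz : z ∈ P.feasibleSet) : P.IsControl z.2 :=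
    ((ControlProblem.isFeasible_iff hU.isClosed).1 hz).1
  have hx (z) (hz : z ∈ P.feasibleSet) : ContinuousOn z.1 (Icc 0 P.T) :=
    ((ControlProblem.isFeasible_iff hU.isClosed).1 hz).2.continuousOn (left_mem_Icc.2 hT.le)
  have hp (z) (hz : z ∈ P.feasibleSet) := hP.isCostate_costate hT.le hU (hμ z hz) (hx z hz)
  have hLH (z) (hz : z ∈ P.feasibleSet) : P.valuesL z = P.valuesH z :=
    hP.valuesL_eq_valuesH hT.le hU (hμ z hz) (hx z hz)
  have hH (z) (hz : z ∈ P.feasibleSet) : IsLeast (P.valuesH z) (P.thetaH z) :=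
    hP.isLeast_thetaH hT hU (hμ z hz) (hx z hz)
  have hL (z) (hz : z ∈ P.feasibleSet) : IsLeast (P.valuesL z) (P.thetaL z) := by
    rw [ControlProblem.thetaL, hLH z hz]
    exact hH z hz
  have hzero (z) (hz : z ∈ P.feasibleSet) := hP.zero_mem_valuesH hT.le hU (hμ z hz)
  have hnonneg (z) (hz : z ∈ P.feasibleSet) (hmin : IsMinOn P.cost P.feasibleSet z) (v)
      (hv : v ∈ P.valuesL z) : 0 ≤ v := hP.nonneg_of_mem_valuesL hT.le hU hz hmin hv
  exact ⟨fun z hz => ⟨⟨hp z hz, fun q hq =>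
      hP.eqOn_of_isCostate hT.le hU (hμ z hz) (hx z hz) hq (hp z hz)⟩, hL z hz, hH z hz⟩,
    isOptimalityFunction_of_isLeast hL (fun z hz => hLH z hz ▸ hzero z hz) hnonneg,
    isOptimalityFunction_of_isLeast hH hzero fun z hz => hLH z hz ▸ hnonneg z hz⟩

theorem mainTheorem5 {n m : ℕ} (P : ControlProblem n m) (hT : 0 < P.T)
    (hUconn : IsConnected P.U) (hUcomp : IsCompact P.U) (hP : P.LipschitzDifferentiable) :
    -- the costate is well defined on `[0,T]`, and the minima defining the two functions exist
    (∀ z ∈ P.feasibleSet,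
      (P.IsCostate z (P.costate z) ∧
        ∀ q, P.IsCostate z q → EqOn q (P.costate z) (Icc 0 P.T)) ∧
      IsLeast (P.valuesL z) (P.thetaL z) ∧
      IsLeast (P.valuesH z) (P.thetaH z)) ∧
    IsOptimalityFunction P.feasibleSet P.cost P.thetaL ∧
    IsOptimalityFunction P.feasibleSet P.cost P.thetaH :=
  have ⟨_, hPL⟩ := hP.exists_isStateRegular
  mainTheorem5_general P hT hUcomp hPL
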